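/- Let $(M,g)$ be a compact smooth Riemannian manifold without boundary, of dimension $d\ge 2$, with Riemannian volume $dg$, gradient $\nabla$ and Laplace-Beltrami operator $\Delta_g$. Let $\kappa>0$, $\lambda\in\{1,-1\}$, $T>0$. Let $H^2(M)$ be the completion of $C^\infty(M;\mathbb C)$ for the norm $(\|f\|_{L^2}^2+\|\nabla f\|_{L^2}^2+\|\Delta_g f\|_{L^2}^2)^{1/2}$ (equivalent on $M$ to the usual $H^2$-norm). Let $(u,v)$ be an $H^2$-solution on $[0,T]$ of the Schrödinger-Debye system $$ i\,\partial_t u+\Delta_g u=uv,\qquad \kappa\,\partial_t v+v=\lambda|u|^2, $$ that is, $u\in C([0,T];H^2(M))\cap C^1([0,T];L^2(M;\mathbb C))$, $v\in C^1([0,T];L^2(M;\mathbb R))$, and both equations hold almost everywhere on $M$ for each $t\in[0,T]$. Then for every $t\in[0,T]$ the functions $|\nabla u(t)|_g^2$, $|u(t)|^2v(t)$ and $|u(t)|^4$ are integrable on $M$, and $$ \frac{d}{dt}\left(\int_M|\nabla u(t)|_g^2\,dg+\int_M|u(t)|^2v(t)\,dg\right)=\frac1\kappa\left(-\int_M|u(t)|^2v(t)\,dg+\lambda\int_M|u(t)|^4\,dg\right),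 $$ where the derivative exists (one-sided at $t=0$ and $t=T$). -/

import Mathlib

open MeasureTheory Set Filter Manifold Bundle
open scoped ContDiff Topology ENNReal

noncomputable section

namespace SchrodingerDebye

section Geometry

/-! A `d`-dimensional manifold without boundary `M` is modelled on `EuclideanSpace ℝ (Fin d)`; the
Riemannian metric `g` is Mathlib's `RiemannianBundle` structure on the tangent bundle, so that
`inner ℝ` and `‖·‖` on `TangentSpace (𝓡 d) x` are the inner product and the norm given by `g`. -/

variable {d : ℕ} {M : Type*} [TopologicalSpace M] [ChartedSpace (EuclideanSpace ℝ (Fin d)) M]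
  [IsManifold (𝓡 d) ∞ M]

/-- The coordinate vector field `∂ᵢ` of the chart centred at `c`, at the point with
coordinates `y`. -/
def coordVec (c : M) (y : EuclideanSpace ℝ (Fin d)) (i : Fin d) :
    TangentSpace (𝓡 d) ((chartAt (EuclideanSpace ℝ (Fin d)) c).symm y) :=
  mfderiv 𝓘(ℝ, EuclideanSpace ℝ (Fin d)) (𝓡 d)
    (chartAt (EuclideanSpace ℝ (Fin d)) c).symm y (EuclideanSpace.single i (1 : ℝ))

variable [RiemannianBundle (fun x : M ↦ TangentSpace (𝓡 d) x)]

/-- The matrix `g_{ij}(y) = g(∂ᵢ, ∂ⱼ)` of the metric in the chart centred at `c`, at the point with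
coordinates `y`. -/
def metricMatrix (c : M) (y : EuclideanSpace ℝ (Fin d)) : Matrix (Fin d) (Fin d) ℝ :=
  Matrix.of fun i j ↦ inner ℝ (coordVec c y i) (coordVec c y j)

/-- The density `√(det g_{ij}(y))` in the chart centred at `c`. -/
def volDensity (c : M) (y : EuclideanSpace ℝ (Fin d)) : ℝ :=
  Real.sqrt (metricMatrix c y).det

variable (d M) in
/-- The Riemannian volume `dg`. For each chart, `√(det g_{ij}) dy` on the range of the chart is
transported to a measure on `M` (which lives on the domain of the chart). These measures agree where
two domains overlap, hence their supremum (in the lattice of measures) is the measure on `M` whose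
restriction to the domain of each chart is `√(det g_{ij}) dy`. -/
def riemannianVolume [MeasurableSpace M] : Measure M :=
  ⨆ c : M, Measure.map (chartAt (EuclideanSpace ℝ (Fin d)) c).symm
    ((volume.restrict (chartAt (EuclideanSpace ℝ (Fin d)) c).target).withDensity
      fun y ↦ ENNReal.ofReal (volDensity c y))

/-- The gradient of a real function: the tangent vector which represents the differential,
`g(∇f(x), w) = df(x) w`. -/
def grad (f : M → ℝ) (x : M) : TangentSpace (𝓡 d) x :=
  haveI : FiniteDimensional ℝ (TangentSpace (𝓡 d) x) :=
    inferInstanceAs (FiniteDimensional ℝ (EuclideanSpace ℝ (Fin d)))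
  haveI : CompleteSpace (TangentSpace (𝓡 d) x) :=
    FiniteDimensional.complete ℝ (TangentSpace (𝓡 d) x)
  (InnerProductSpace.toDual ℝ (TangentSpace (𝓡 d) x)).symm (mfderiv (𝓡 d) 𝓘(ℝ, ℝ) f x)

variable (d) in
/-- The complexified tangent space: `X + iY` is the pair `(X, Y)`, with
`|X + iY|² = |X|² + |Y|²`. -/
abbrev ComplexTangentSpace (x : M) : Type :=
  WithLp 2 (TangentSpace (𝓡 d) x × TangentSpace (𝓡 d) x)

/-- The gradient `∇f = ∇(Re f) + i ∇(Im f)` of a complex function. -/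
def complexGrad (f : M → ℂ) (x : M) : ComplexTangentSpace d x :=
  WithLp.toLp 2 (grad (fun z ↦ (f z).re) x, grad (fun z ↦ (f z).im) x)

/-- The Laplace-Beltrami operator, `Δf = (det g)^{-1/2} ∑ᵢⱼ ∂ᵢ((det g)^{1/2} g^{ij} ∂ⱼf)`,
computed at `x` in the chart centred at `x`. -/
def laplaceBeltrami (f : M → ℂ) (x : M) : ℂ :=
  (((volDensity x (chartAt (EuclideanSpace ℝ (Fin d)) x x))⁻¹ : ℝ) : ℂ) *
    ∑ i : Fin d, ∑ j : Fin d,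
      fderiv ℝ (fun y ↦ ((volDensity x y * (metricMatrix x y)⁻¹ i j : ℝ) : ℂ) *
          fderiv ℝ (fun z ↦ f ((chartAt (EuclideanSpace ℝ (Fin d)) x).symm z)) y
            (EuclideanSpace.single j (1 : ℝ)))
        (chartAt (EuclideanSpace ℝ (Fin d)) x x) (EuclideanSpace.single i (1 : ℝ))

variable [MeasurableSpace M]

variable (d M) in
/-- The space `L²(M; F)` for the Riemannian volume. -/
abbrev L2 (F : Type*) [NormedAddCommGroup F] := Lp F 2 (riemannianVolume d M)

/-- `u ∈ L²(M; ℂ)` belongs to `H²(M)`, with weak gradient `X` and weak Laplacian `w`.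

`H²(M)` is the completion of `C^∞(M; ℂ)` for the norm
`(‖f‖² + ‖∇f‖² + ‖Δf‖²)^{1/2}` (`L²`-norms), which on a compact manifold is equivalent to the usual
`H²`-norm; so there are smooth `f n` with `f n → u`, `∇(f n) → X` and `Δ(f n) → w` in `L²`.
As `X` is a section of a bundle and not an element of a space `Lp`, its measurability is ensured by
asking also for `∇(f n) → X` almost everywhere, which passing to a subsequence achieves. -/
def IsH2Function (u : L2 d M ℂ) (X : ∀ x : M, ComplexTangentSpace d x) (w : L2 d M ℂ) : Prop :=
  ∃ f : ℕ → M → ℂ, (∀ n, ContMDiff (𝓡 d) 𝓘(ℝ, ℂ) ∞ (f n)) ∧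
    Tendsto (fun n ↦ ∫⁻ x, ‖f n x - u x‖ₑ ^ 2 ∂riemannianVolume d M) atTop (𝓝 0) ∧
    Tendsto (fun n ↦ ∫⁻ x, ‖complexGrad (f n) x - X x‖ₑ ^ 2 ∂riemannianVolume d M)
      atTop (𝓝 0) ∧
    (∀ᵐ x ∂riemannianVolume d M, Tendsto (fun n ↦ complexGrad (f n) x) atTop (𝓝 (X x))) ∧
    Tendsto (fun n ↦ ∫⁻ x, ‖laplaceBeltrami (d := d) (f n) x - w x‖ₑ ^ 2 ∂riemannianVolume d M)
      atTop (𝓝 0)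

/-- `(u, v)` is an `H²`-solution on `[0, T]` of the Schrödinger-Debye system
`i ∂ₜu + Δu = uv`, `κ ∂ₜv + v = λ|u|²`, and `∇u(t)`, `Δu(t)` are the weak gradient and Laplacian
of `u(t)`: `u ∈ C([0,T]; H²(M)) ∩ C¹([0,T]; L²(M))`, `v ∈ C¹([0,T]; L²(M))` is real valued, and at
each time both equations hold in `L²(M)`. Time derivatives are taken in `L²(M)` (one-sided
at `0` and `T`). -/
structure IsH2Solution (κ lam T : ℝ) (u : ℝ → L2 d M ℂ) (v : ℝ → L2 d M ℝ)
    (gradu : ℝ → ∀ x : M, ComplexTangentSpace d x) (lapu : ℝ → L2 d M ℂ) : Prop where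
  isH2Function : ∀ t ∈ Icc 0 T, IsH2Function (u t) (gradu t) (lapu t)
  continuousOn_lap : ContinuousOn lapu (Icc 0 T)
  contDiffOn_u : ContDiffOn ℝ 1 u (Icc 0 T)
  contDiffOn_v : ContDiffOn ℝ 1 v (Icc 0 T)
  schrodinger : ∀ t ∈ Icc 0 T, ∀ᵐ x ∂riemannianVolume d M,
    Complex.I * (derivWithin u (Icc 0 T) t : L2 d M ℂ) x + lapu t x = u t x * (v t x : ℂ)
  debye : ∀ t ∈ Icc 0 T, ∀ᵐ x ∂riemannianVolume d M,
    κ * (derivWithin v (Icc 0 T) t : L2 d M ℝ) x + v t x = lam * ‖u t x‖ ^ 2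

end Geometry

end SchrodingerDebye

end

/-! Formally, the energy is `-⟨Δu, u⟩ + ∫ |u|² v` for the real inner product of `L²`. The two terms
have derivatives `-2⟨Δu, ∂ₜu⟩` and `⟨|u|², ∂ₜv⟩ + 2⟨uv, ∂ₜu⟩`. Since `uv - Δu = i ∂ₜu` is orthogonal
to `∂ₜu`, only `⟨|u|², ∂ₜv⟩` survives, and the Debye equation turns it into the right-hand side.

The regularity for this comes from the equations and not from Sobolev embeddings, so the dimension
plays no role: `|u|² = λ(κ ∂ₜv + v)` and `uv = i ∂ₜu + Δu` are continuous in time with values in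
`L²`. The map `t ↦ Δu(t)` is merely continuous, but symmetry of `Δ` gives `⟨Δu(s), u(s)⟩ - ⟨Δu(t),
u(t)⟩ = ⟨Δu(s) + Δu(t), u(s) - u(t)⟩`, which only needs `u` to be differentiable
(`hasDerivWithinAt_inner_of_symmetric`). The cubic term is treated by a similar symmetric identity
(`inner_sub_inner_eq`), whose remainder `|u(s) - u(t)|² (v(s) - v(t))` is negligible because `|u(s)
- u(t)|²` tends to zero weakly in `L²` (`tendsto_inner_normSq_sub`).

Geometry enters through Green's formula (`integral_inner_laplaceBeltrami`), proved for smooth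
functions in charts and glued by a partition of unity. Approximation carries over to `H²` both the
symmetry of `Δ` and the equality of `∫ |∇u|²` with `-⟨Δu, u⟩`. -/

noncomputable section

namespace SchrodingerDebye

/-! ### Differentiating a pairing whose second factor vanishes. -/

section WeakDerivative

variable {E : Type*} [NormedAddCommGroup E] [InnerProductSpace ℝ E]

/-- As `w t = 0`, the slope is `⟨A s, slope w⟩`, which splits into `⟨A s, slope w - w'⟩`, small
because `A` is bounded, and `⟨A s, w'⟩`. Hence no strong continuity of `A` is needed. -/
theorem hasDerivWithinAt_inner_of_tendsto_inner {A w : ℝ → E} {w' : E} {L C t : ℝ} {I : Set ℝ}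
    (hC : ∀ s ∈ I, ‖A s‖ ≤ C)
    (hA : Tendsto (fun s ↦ inner ℝ (A s) w') (𝓝[I] t) (𝓝 L))
    (hw : HasDerivWithinAt w w' I t) (hwt : w t = 0) :
    HasDerivWithinAt (fun s ↦ inner ℝ (A s) (w s)) L I t := by
  rw [hasDerivWithinAt_iff_tendsto_slope] at hw ⊢
  have h0 : Tendsto (fun s ↦ inner ℝ (A s) (slope w t s - w')) (𝓝[I \ {t}] t) (𝓝 0) := by
    have h1 : Tendsto (fun s ↦ C * ‖slope w t s - w'‖) (𝓝[I \ {t}] t) (𝓝 0) := by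
      have := ((hw.sub_const w').norm).const_mul C
      simpa using this
    refine squeeze_zero_norm' ?_ h1
    filter_upwards [self_mem_nhdsWithin] with s hs
    exact (norm_inner_le_norm _ _).trans
      (mul_le_mul_of_nonneg_right (hC s hs.1) (norm_nonneg _))
  have h2 := h0.add (hA.mono_left (nhdsWithin_mono t sdiff_subset))
  rw [zero_add] at h2
  refine h2.congr fun s ↦ ?_
  simp only [slope_def_module, hwt, inner_zero_right, sub_zero, inner_sub_right, inner_smul_right,
    smul_eq_mul, sub_add_cancel]

theorem hasDerivWithinAt_inner_of_continuousOn {A w : ℝ → E} {w' : E} {t : ℝ} {I : Set ℝ}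
    (hI : IsCompact I) (ht : t ∈ I) (hA : ContinuousOn A I)
    (hw : HasDerivWithinAt w w' I t) (hwt : w t = 0) :
    HasDerivWithinAt (fun s ↦ inner ℝ (A s) (w s)) (inner ℝ (A t) w') I t := by
  obtain ⟨C, hC⟩ := hI.exists_bound_of_continuousOn hA
  exact hasDerivWithinAt_inner_of_tendsto_inner hC
    (Filter.Tendsto.inner (hA t ht) tendsto_const_nhds) hw hwt

end WeakDerivative

/-! ### Square moduli in `L²` and the algebra of the cubic term. -/

section SquareIntegrable

variable {α : Type*} [MeasurableSpace α] {μ : Measure α}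

theorem memLp_normSq_sub {a b : Lp ℂ 2 μ} {ρa ρb : Lp ℝ 2 μ}
    (ha : ∀ᵐ x ∂μ, ρa x = ‖a x‖ ^ 2) (hb : ∀ᵐ x ∂μ, ρb x = ‖b x‖ ^ 2) :
    MemLp (fun x ↦ ‖a x - b x‖ ^ 2) 2 μ := by
  refine ((Lp.memLp ρa).add (Lp.memLp ρb)).of_le_mul (c := 2) ?_ ?_
  · exact ((Lp.aestronglyMeasurable a).sub (Lp.aestronglyMeasurable b)).norm.pow 2
  · filter_upwards [ha, hb] with x hxa hxb
    simp only [Pi.add_apply, hxa, hxb]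
    rw [Real.norm_of_nonneg (by positivity), Real.norm_of_nonneg (by positivity)]
    have := norm_sub_le (a x) (b x)
    nlinarith [sq_nonneg (‖a x‖ - ‖b x‖), norm_nonneg (a x - b x), norm_nonneg (a x),
      norm_nonneg (b x)]

/-- The constant is that of `|a - b|² ≤ 2(|a|² + |b|²)`. -/
theorem norm_normSq_sub_le {a b : Lp ℂ 2 μ} {ρa ρb : Lp ℝ 2 μ}
    (ha : ∀ᵐ x ∂μ, ρa x = ‖a x‖ ^ 2) (hb : ∀ᵐ x ∂μ, ρb x = ‖b x‖ ^ 2) :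
    ‖(memLp_normSq_sub ha hb).toLp _‖ ≤ 2 * (‖ρa‖ + ‖ρb‖) := by
  have h : ‖(memLp_normSq_sub ha hb).toLp _‖ ≤ 2 * ‖ρa + ρb‖ := by
    refine Lp.norm_le_mul_norm_of_ae_le_mul ?_
    filter_upwards [ha, hb, (memLp_normSq_sub ha hb).coeFn_toLp, Lp.coeFn_add ρa ρb]
      with x hxa hxb hx hab
    rw [hx, hab]
    simp only [Pi.add_apply, hxa, hxb]
    rw [Real.norm_of_nonneg (by positivity), Real.norm_of_nonneg (by positivity)]
    have := norm_sub_le (a x) (b x)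
    nlinarith [sq_nonneg (‖a x‖ - ‖b x‖), norm_nonneg (a x - b x), norm_nonneg (a x),
      norm_nonneg (b x)]
  exact h.trans (by gcongr; exact norm_add_le _ _)

theorem integral_norm_sq_eq (a : Lp ℂ 2 μ) : ∫ x, ‖a x‖ ^ 2 ∂μ = ‖a‖ ^ 2 := by
  rw [← real_inner_self_eq_norm_sq, L2.inner_def]
  simp only [real_inner_self_eq_norm_sq]

theorem integrable_norm_sq (a : Lp ℂ 2 μ) : Integrable (fun x ↦ ‖a x‖ ^ 2) μ := by
  have := L2.integrable_inner (𝕜 := ℝ) a a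
  simpa only [real_inner_self_eq_norm_sq] using this

/-- Bounded in `L²` and tending to zero in `L¹`, the functions `|u(s) - u(t)|²` tend to zero weakly
in `L²`. -/
theorem tendsto_inner_normSq_sub {I : Set ℝ} {t : ℝ} (ht : t ∈ I) {u : ℝ → Lp ℂ 2 μ}
    {q : ℝ → Lp ℝ 2 μ} {C : ℝ} (hu : ContinuousWithinAt u I t)
    (hq : ∀ s ∈ I, ∀ᵐ x ∂μ, q s x = ‖u s x - u t x‖ ^ 2)
    (hC : ∀ s ∈ I, ‖q s‖ ≤ C) (φ : Lp ℝ 2 μ) :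
    Tendsto (fun s ↦ inner ℝ (q s) φ) (𝓝[I] t) (𝓝 0) := by
  have hC0 : 0 ≤ C := (norm_nonneg _).trans (hC t ht)
  refine Lp.induction (by simp) (fun φ : Lp ℝ 2 μ ↦
    Tendsto (fun s ↦ inner ℝ (q s) φ) (𝓝[I] t) (𝓝 0)) ?_ ?_ ?_ φ
  · intro c S hS hμS
    -- Against `c` times the indicator of `S`, the pairing is at most `|c|` times the `L¹` norm of
    -- `q s`, which is `‖u s - u t‖²`.
    have h1 : Tendsto (fun s ↦ |c| * ‖u s - u t‖ ^ 2) (𝓝[I] t) (𝓝 0) := by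
      have := (((hu.tendsto.sub_const (u t)).norm).pow 2).const_mul |c|
      simpa using this
    refine squeeze_zero_norm' ?_ h1
    filter_upwards [self_mem_nhdsWithin] with s hs
    rw [real_inner_comm, Lp.simpleFunc.coe_indicatorConst,
      L2.inner_indicatorConstLp_eq_setIntegral_inner, ← integral_norm_sq_eq,
      ← integral_const_mul, ← integral_indicator hS]
    refine norm_integral_le_of_norm_le ((integrable_norm_sq _).const_mul _) ?_
    filter_upwards [hq s hs, Lp.coeFn_sub (u s) (u t)] with x hx hx'
    rw [hx', Pi.sub_apply]
    by_cases hxS : x ∈ S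
    · rw [indicator_of_mem hxS, hx]
      simp [mul_comm]
    · rw [indicator_of_notMem hxS, norm_zero]; positivity
  · intro f g hf hg _ hf' hg'
    simpa [inner_add_right] using hf'.add hg'
  · refine isClosed_of_closure_subset fun f hf ↦ ?_
    rw [mem_ofPred, Metric.tendsto_nhds]
    intro ε hε
    -- The uniform bound `C` makes the set of good `φ` closed; `C + 1` avoids dividing by zero.
    obtain ⟨g, hg, hfg⟩ := Metric.mem_closure_iff.1 hf (ε / (2 * (C + 1))) (by positivity)
    filter_upwards [Metric.tendsto_nhds.1 hg (ε / 2) (by positivity), self_mem_nhdsWithin]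
      with s hs hsI
    rw [Real.dist_eq, sub_zero] at hs ⊢
    have e : inner ℝ (q s) f = inner ℝ (q s) g + inner ℝ (q s) (f - g) := by
      rw [inner_sub_right]; ring
    have h2 : |inner ℝ (q s) (f - g)| ≤ C * (ε / (2 * (C + 1))) := by
      refine (abs_real_inner_le_norm _ _).trans ?_
      rw [← dist_eq_norm]
      exact mul_le_mul (hC s hsI) hfg.le dist_nonneg hC0
    have h3 : C * (ε / (2 * (C + 1))) ≤ ε / 2 := by
      rw [mul_div_assoc', div_le_div_iff₀ (by positivity) (by positivity)]
      nlinarith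
    rw [e]
    linarith [abs_add_le (inner ℝ (q s) g) (inner ℝ (q s) (f - g))]

/-- Pointwise, `(a va + b vb)·(a - b)` equals `½(|a|² - |b|²)(va + vb) + ½|a - b|²(va - vb)`. Each
increment is thus paired with a factor known to be in `L²`, namely `ρ`, `W` or `q`. -/
theorem inner_sub_inner_eq {a b Wa Wb : Lp ℂ 2 μ} {ρa ρb va vb q : Lp ℝ 2 μ}
    (ha : ∀ᵐ x ∂μ, ρa x = ‖a x‖ ^ 2) (hb : ∀ᵐ x ∂μ, ρb x = ‖b x‖ ^ 2)
    (hWa : ∀ᵐ x ∂μ, Wa x = a x * (va x : ℂ)) (hWb : ∀ᵐ x ∂μ, Wb x = b x * (vb x : ℂ))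
    (hq : ∀ᵐ x ∂μ, q x = ‖a x - b x‖ ^ 2) :
    inner ℝ ρa va - inner ℝ ρb vb =
      (1 / 2) * inner ℝ (ρa + ρb) (va - vb) + inner ℝ (Wa + Wb) (a - b)
        - (1 / 2) * inner ℝ q (va - vb) := by
  simp only [L2.inner_def]
  rw [← integral_sub (L2.integrable_inner _ _) (L2.integrable_inner _ _), ← integral_const_mul,
    ← integral_const_mul, ← integral_add ((L2.integrable_inner _ _).const_mul _)
      (L2.integrable_inner _ _),
    ← integral_sub (((L2.integrable_inner _ _).const_mul _).add (L2.integrable_inner _ _))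
      ((L2.integrable_inner _ _).const_mul _)]
  refine integral_congr_ae ?_
  filter_upwards [ha, hb, hWa, hWb, hq, Lp.coeFn_add ρa ρb, Lp.coeFn_sub va vb,
    Lp.coeFn_add Wa Wb, Lp.coeFn_sub a b] with x h1 h2 h3 h4 h5 h6 h7 h8 h9
  simp only [h6, h7, h8, h9, Pi.add_apply, Pi.sub_apply, h1, h2, h3, h4, h5, Complex.inner,
    ← Complex.normSq_eq_norm_sq, Complex.normSq_apply, Real.inner_apply]
  simp only [map_add, map_mul, Complex.conj_ofReal, Complex.mul_re, Complex.add_re, Complex.add_im,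
    Complex.mul_im, Complex.sub_re, Complex.sub_im, Complex.conj_re, Complex.conj_im,
    Complex.ofReal_re, Complex.ofReal_im]
  ring

theorem inner_I_smul_self (f : Lp ℂ 2 μ) : inner ℝ (Complex.I • f) f = 0 := by
  rw [L2.inner_def]
  refine integral_eq_zero_of_ae ?_
  filter_upwards [Lp.coeFn_smul Complex.I f] with x hx
  rw [hx]
  simp [Complex.inner]
  ring

end SquareIntegrable

/-! ### The energy identity in an abstract `L²` space. -/

section Energy

variable {α : Type*} [MeasurableSpace α] {μ : Measure α}

/-- The three terms of `inner_sub_inner_eq` are differentiated separately. The first two have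
strongly continuous coefficients; the last contributes zero, its coefficient being bounded and
weakly null. -/
theorem hasDerivWithinAt_inner_normSq {I : Set ℝ} (hI : IsCompact I) {t : ℝ} (ht : t ∈ I)
    {u W : ℝ → Lp ℂ 2 μ} {ρ v : ℝ → Lp ℝ 2 μ} {u' : Lp ℂ 2 μ} {v' : Lp ℝ 2 μ}
    (hu : HasDerivWithinAt u u' I t) (hv : HasDerivWithinAt v v' I t)
    (hWc : ContinuousOn W I) (hρc : ContinuousOn ρ I)
    (hρ : ∀ s ∈ I, ∀ᵐ x ∂μ, ρ s x = ‖u s x‖ ^ 2)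
    (hW : ∀ s ∈ I, ∀ᵐ x ∂μ, W s x = u s x * (v s x : ℂ)) :
    HasDerivWithinAt (fun s ↦ inner ℝ (ρ s) (v s)) (inner ℝ (ρ t) v' + 2 * inner ℝ (W t) u')
      I t := by
  classical
  -- Square integrability of `|u s - u t|²` is known only for `s ∈ I`; the value outside is
  -- immaterial.
  let q : ℝ → Lp ℝ 2 μ := fun s ↦
    if hs : s ∈ I then (memLp_normSq_sub (hρ s hs) (hρ t ht)).toLp _ else 0
  have hq : ∀ s ∈ I, ∀ᵐ x ∂μ, q s x = ‖u s x - u t x‖ ^ 2 := by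
    intro s hs
    simp only [q, dif_pos hs]
    exact (memLp_normSq_sub (hρ s hs) (hρ t ht)).coeFn_toLp
  obtain ⟨C, hC⟩ := hI.exists_bound_of_continuousOn hρc
  have hqC : ∀ s ∈ I, ‖q s‖ ≤ 2 * (C + C) := by
    intro s hs
    simp only [q, dif_pos hs]
    refine (norm_normSq_sub_le (hρ s hs) (hρ t ht)).trans ?_
    linarith [hC s hs, hC t ht]
  have du : HasDerivWithinAt (fun s ↦ u s - u t) u' I t := hu.sub_const _
  have dv : HasDerivWithinAt (fun s ↦ v s - v t) v' I t := hv.sub_const _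
  have d1 := hasDerivWithinAt_inner_of_continuousOn hI ht (hρc.add continuousOn_const) dv
    (sub_self (v t)) (A := fun s ↦ ρ s + ρ t)
  have d2 := hasDerivWithinAt_inner_of_continuousOn hI ht (hWc.add continuousOn_const) du
    (sub_self (u t)) (A := fun s ↦ W s + W t)
  have d3 := hasDerivWithinAt_inner_of_tendsto_inner hqC
    (tendsto_inner_normSq_sub ht hu.continuousWithinAt hq hqC v') dv (sub_self (v t))
  have d := (((d1.const_mul (1 / 2)).add d2).sub (d3.const_mul (1 / 2))).add_const
    (inner ℝ (ρ t) (v t))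
  refine HasDerivWithinAt.congr_deriv (HasDerivWithinAt.congr d ?_ ?_) ?_
  · intro s hs
    have := inner_sub_inner_eq (hρ s hs) (hρ t ht) (hW s hs) (hW t ht) (hq s hs)
    simp only [Pi.add_apply, Pi.sub_apply]
    linarith
  · simp
  · rw [inner_add_left, inner_add_left]
    ring

/-- By symmetry the increment is `⟨L s + L t, u s - u t⟩`, so `L` need not be differentiable. -/
theorem hasDerivWithinAt_inner_of_symmetric {E : Type*} [NormedAddCommGroup E]
    [InnerProductSpace ℝ E] {I : Set ℝ} (hI : IsCompact I) {t : ℝ} (ht : t ∈ I)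
    {u L : ℝ → E} {u' : E} (hu : HasDerivWithinAt u u' I t) (hL : ContinuousOn L I)
    (hsymm : ∀ s ∈ I, inner ℝ (L s) (u t) = inner ℝ (L t) (u s)) :
    HasDerivWithinAt (fun s ↦ inner ℝ (L s) (u s)) (2 * inner ℝ (L t) u') I t := by
  have du : HasDerivWithinAt (fun s ↦ u s - u t) u' I t := hu.sub_const _
  have d := (hasDerivWithinAt_inner_of_continuousOn hI ht (hL.add continuousOn_const) du
    (sub_self (u t)) (A := fun s ↦ L s + L t)).add_const (inner ℝ (L t) (u t))
  refine HasDerivWithinAt.congr_deriv (HasDerivWithinAt.congr d ?_ ?_) ?_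
  · intro s hs
    simp only [inner_add_left, inner_sub_right]
    linarith [hsymm s hs]
  · simp
  · simp only [inner_add_left]
    ring

theorem hasDerivWithinAt_energy {κ lam T : ℝ} (hκ : 0 < κ) (hlam : lam = 1 ∨ lam = -1)
    {u L u' : ℝ → Lp ℂ 2 μ} {v v' : ℝ → Lp ℝ 2 μ}
    (hu : ∀ t ∈ Icc 0 T, HasDerivWithinAt u (u' t) (Icc 0 T) t)
    (hv : ∀ t ∈ Icc 0 T, HasDerivWithinAt v (v' t) (Icc 0 T) t)
    (hu' : ContinuousOn u' (Icc 0 T)) (hv' : ContinuousOn v' (Icc 0 T))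
    (hL : ContinuousOn L (Icc 0 T))
    (hsymm : ∀ s ∈ Icc 0 T, ∀ t ∈ Icc 0 T, inner ℝ (L s) (u t) = inner ℝ (L t) (u s))
    (schrodinger : ∀ t ∈ Icc 0 T, ∀ᵐ x ∂μ,
      Complex.I * u' t x + L t x = u t x * (v t x : ℂ))
    (debye : ∀ t ∈ Icc 0 T, ∀ᵐ x ∂μ, κ * v' t x + v t x = lam * ‖u t x‖ ^ 2) :
    ∀ t ∈ Icc 0 T,
      Integrable (fun x ↦ ‖u t x‖ ^ 2 * v t x) μ ∧ Integrable (fun x ↦ ‖u t x‖ ^ 4) μ ∧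
      HasDerivWithinAt (fun s ↦ - inner ℝ (L s) (u s) + ∫ x, ‖u s x‖ ^ 2 * v s x ∂μ)
        (1 / κ * (-(∫ x, ‖u t x‖ ^ 2 * v t x ∂μ) + lam * ∫ x, ‖u t x‖ ^ 4 ∂μ)) (Icc 0 T) t := by
  have hlam2 : lam * lam = 1 := by rcases hlam with rfl | rfl <;> norm_num
  -- The two equations, solved for `|u|²` (with `λ⁻¹ = λ`) and for `uv`, exhibit both as continuous
  -- curves in `L²`.
  set ρ : ℝ → Lp ℝ 2 μ := fun s ↦ lam • (κ • v' s + v s) with hρdef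
  set W : ℝ → Lp ℂ 2 μ := fun s ↦ Complex.I • u' s + L s with hWdef
  have hρ : ∀ s ∈ Icc 0 T, ∀ᵐ x ∂μ, ρ s x = ‖u s x‖ ^ 2 := by
    intro s hs
    filter_upwards [debye s hs, Lp.coeFn_smul lam (κ • v' s + v s),
      Lp.coeFn_add (κ • v' s) (v s), Lp.coeFn_smul κ (v' s)] with x h1 h2 h3 h4
    simp only [hρdef, h2, Pi.smul_apply, h3, Pi.add_apply, h4, smul_eq_mul, h1]
    rw [← mul_assoc, hlam2, one_mul]
  have hW : ∀ s ∈ Icc 0 T, ∀ᵐ x ∂μ, W s x = u s x * (v s x : ℂ) := by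
    intro s hs
    filter_upwards [schrodinger s hs, Lp.coeFn_add (Complex.I • u' s) (L s),
      Lp.coeFn_smul Complex.I (u' s)] with x h1 h2 h3
    simp only [hWdef, h2, Pi.add_apply, h3, Pi.smul_apply, smul_eq_mul, h1]
  have hvc : ContinuousOn v (Icc 0 T) := fun s hs ↦ (hv s hs).continuousWithinAt
  have hρc : ContinuousOn ρ (Icc 0 T) := ((hv'.const_smul κ).add hvc).const_smul lam
  have hWc : ContinuousOn W (Icc 0 T) := (hu'.const_smul Complex.I).add hL
  have hρv : ∀ s ∈ Icc 0 T, (fun x ↦ inner ℝ (ρ s x) (v s x)) =ᵐ[μ]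
      fun x ↦ ‖u s x‖ ^ 2 * v s x := by
    intro s hs
    filter_upwards [hρ s hs] with x hx
    rw [hx, Real.inner_apply]
  have hρρ : ∀ s ∈ Icc 0 T, (fun x ↦ inner ℝ (ρ s x) (ρ s x)) =ᵐ[μ] fun x ↦ ‖u s x‖ ^ 4 := by
    intro s hs
    filter_upwards [hρ s hs] with x hx
    rw [hx, Real.inner_apply]; ring
  have iρv : ∀ s ∈ Icc 0 T, inner ℝ (ρ s) (v s) = ∫ x, ‖u s x‖ ^ 2 * v s x ∂μ := fun s hs ↦ by
    rw [L2.inner_def, integral_congr_ae (hρv s hs)]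
  intro t ht
  refine ⟨(L2.integrable_inner _ _).congr (hρv t ht), (L2.integrable_inner _ _).congr (hρρ t ht), ?_⟩
  have d1 := hasDerivWithinAt_inner_of_symmetric isCompact_Icc ht (hu t ht) hL
    (fun s hs ↦ hsymm s hs t ht)
  have d2 := hasDerivWithinAt_inner_normSq isCompact_Icc ht (hu t ht) (hv t ht) hWc hρc hρ hW
  refine HasDerivWithinAt.congr_deriv (HasDerivWithinAt.congr (d1.neg.add d2) ?_ ?_) ?_
  · intro s hs
    simp [iρv s hs]
  · simp [iρv t ht]
  · have e1 : inner ℝ (ρ t) (v' t) =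
        1 / κ * (-inner ℝ (ρ t) (v t) + lam * inner ℝ (ρ t) (ρ t)) := by
      have : lam • ρ t = κ • v' t + v t := by
        simp only [hρdef, smul_smul, hlam2, one_smul]
      rw [← inner_smul_right, this, inner_add_right, inner_smul_right]
      field_simp
      ring
    have e2 : inner ℝ (ρ t) (ρ t) = ∫ x, ‖u t x‖ ^ 4 ∂μ := by
      rw [L2.inner_def, integral_congr_ae (hρρ t ht)]
    rw [e1, e2, iρv t ht]
    -- The `L t` parts cancel, and `i u'` is orthogonal to `u'`.
    simp only [hWdef, inner_add_left, inner_I_smul_self]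
    ring

end Energy

/-! ### Inner products in a non-orthonormal basis. -/

section LinearAlgebra

/-- The coordinates of `q` are the inverse Gram matrix applied to the pairings of `q` with the
basis. For gradients these pairings are partial derivatives. -/
theorem inner_eq_sum_gram_inv {n V : Type*} [Fintype n] [DecidableEq n] [NormedAddCommGroup V]
    [InnerProductSpace ℝ V] (b : Module.Basis n ℝ V) (p q : V) :
    inner ℝ p q = ∑ i, ∑ j, (Matrix.gram ℝ b)⁻¹ i j * inner ℝ q (b j) * inner ℝ p (b i) := by
  have hG : IsUnit (Matrix.gram ℝ b).det :=
    (Matrix.posDef_gram_of_linearIndependent b.linearIndependent).det_pos.ne'.isUnit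
  have hq : (Matrix.gram ℝ b).mulVec (fun j ↦ b.repr q j) = fun i ↦ inner ℝ q (b i) := by
    funext i
    conv_rhs => rw [← b.sum_repr q]
    simp only [Matrix.mulVec, dotProduct, Matrix.gram_apply, sum_inner, real_inner_smul_left]
    exact Finset.sum_congr rfl fun j _ ↦ by rw [real_inner_comm, mul_comm]
  have hq' : (fun j ↦ b.repr q j) =
      (Matrix.gram ℝ b)⁻¹.mulVec (fun i ↦ inner ℝ q (b i)) := by
    rw [← hq, Matrix.mulVec_mulVec, Matrix.nonsing_inv_mul _ hG, Matrix.one_mulVec]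
  conv_lhs => rw [← b.sum_repr q]
  simp only [inner_sum, real_inner_smul_right]
  refine Finset.sum_congr rfl fun i _ ↦ ?_
  rw [congrFun hq' i, Matrix.mulVec, dotProduct, Finset.sum_mul]

theorem clm_apply_eq_sum {d : ℕ} (A : EuclideanSpace ℝ (Fin d) →L[ℝ] EuclideanSpace ℝ (Fin d))
    (w : EuclideanSpace ℝ (Fin d)) : A w = ∑ k, w k • A (EuclideanSpace.single k (1 : ℝ)) := by
  conv_lhs => rw [← (EuclideanSpace.basisFun (Fin d) ℝ).sum_repr w, map_sum]
  simp only [map_smul, EuclideanSpace.basisFun_apply, EuclideanSpace.basisFun_repr]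

end LinearAlgebra

/-! ### Coordinate vectors, the metric and its density in charts. -/

section ChartGeometry

variable {d : ℕ} {M : Type*} [TopologicalSpace M] [ChartedSpace (EuclideanSpace ℝ (Fin d)) M]
  [IsManifold (𝓡 d) ∞ M]

local notation "𝔼" => EuclideanSpace ℝ (Fin d)

theorem mdifferentiable_chartAt (c : M) :
    (chartAt 𝔼 c).MDifferentiable (𝓡 d) (𝓡 d) :=
  have : IsManifold (𝓡 d) 1 M := IsManifold.of_le (n := ∞) (by norm_cast)
  mdifferentiable_chart c

/-- The coordinate vector fields of a chart form a basis of the tangent space. -/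
def coordBasis (c : M) {y : 𝔼} (hy : y ∈ (chartAt 𝔼 c).target) :
    Module.Basis (Fin d) ℝ (TangentSpace (𝓡 d) ((chartAt 𝔼 c).symm y)) :=
  (EuclideanSpace.basisFun (Fin d) ℝ).toBasis.map
    (LinearEquiv.ofBijective (mfderiv (𝓡 d) (𝓡 d) (chartAt 𝔼 c).symm y).toLinearMap
      ((mdifferentiable_chartAt c).symm.mfderiv_bijective hy))

theorem coe_coordBasis (c : M) {y : 𝔼} (hy : y ∈ (chartAt 𝔼 c).target) :
    ⇑(coordBasis c hy) = coordVec c y := by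
  funext i
  have h : (EuclideanSpace.basisFun (Fin d) ℝ).toBasis i = EuclideanSpace.single i (1 : ℝ) := by
    simp
  exact (Module.Basis.map_apply _ _ i).trans
    (congrArg (mfderiv (𝓡 d) (𝓡 d) (chartAt 𝔼 c).symm y) h)

theorem contMDiffOn_coordVec (c : M) (i : Fin d) :
    ContMDiffOn (𝓡 d) (𝓡 d).tangent ∞
      (fun y ↦ (⟨(chartAt 𝔼 c).symm y, coordVec c y i⟩ : TangentBundle (𝓡 d) M))
      (chartAt 𝔼 c).target := by
  have hopen : IsOpen (chartAt 𝔼 c).target := (chartAt 𝔼 c).open_target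
  have h1 := (contMDiffOn_chart_symm (I := 𝓡 d) (n := ∞) (x := c)).contMDiffOn_tangentMapWithin
    (m := ∞) le_rfl hopen.uniqueMDiffOn
  have h2 : ContMDiffOn (𝓡 d) (𝓡 d).tangent ∞
      (fun y : 𝔼 ↦ (⟨y, EuclideanSpace.single i (1 : ℝ)⟩ : TangentBundle (𝓡 d) 𝔼))
      (chartAt 𝔼 c).target :=
    contMDiffOn_vectorSpace_iff_contDiffOn.2 contDiffOn_const
  refine (h1.comp h2 fun y hy ↦ hy).congr fun y hy ↦ ?_
  simp only [Function.comp_apply, tangentMapWithin, coordVec]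
  rw [mfderivWithin_of_isOpen hopen hy]

theorem contDiffOn_comp_chart_symm {F : Type*} [NormedAddCommGroup F] [NormedSpace ℝ F]
    {f : M → F} (hf : ContMDiff (𝓡 d) 𝓘(ℝ, F) ∞ f) (c : M) :
    ContDiffOn ℝ ∞ (fun y ↦ f ((chartAt 𝔼 c).symm y)) (chartAt 𝔼 c).target :=
  (hf.comp_contMDiffOn (contMDiffOn_chart_symm (I := 𝓡 d) (n := ∞) (x := c))).contDiffOn

theorem mfderiv_coordVec {f : M → ℝ} (hf : ContMDiff (𝓡 d) 𝓘(ℝ, ℝ) ∞ f) (c : M) {y : 𝔼}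
    (hy : y ∈ (chartAt 𝔼 c).target) (i : Fin d) :
    mfderiv (𝓡 d) 𝓘(ℝ, ℝ) f ((chartAt 𝔼 c).symm y) (coordVec c y i) =
      fderiv ℝ (fun z ↦ f ((chartAt 𝔼 c).symm z)) y (EuclideanSpace.single i (1 : ℝ)) := by
  have hfd := hf.mdifferentiable (by simp) ((chartAt 𝔼 c).symm y)
  have h := mfderiv_comp y hfd ((mdifferentiable_chartAt c).symm.mdifferentiableAt hy)
  rw [← mfderiv_eq_fderiv]
  exact (DFunLike.congr_fun h (EuclideanSpace.single i (1 : ℝ))).symm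

/-- The change of coordinates from the chart at `b` to the chart at `c`. -/
def transition (b c : M) (y : 𝔼) : 𝔼 := chartAt 𝔼 c ((chartAt 𝔼 b).symm y)

theorem hasFDerivAt_transition {b c : M} {y : 𝔼} (hy : y ∈ (chartAt 𝔼 b).target)
    (hyc : (chartAt 𝔼 b).symm y ∈ (chartAt 𝔼 c).source) :
    HasFDerivAt (transition b c) (fderiv ℝ (transition b c) y) y := by
  have h1 := ((mdifferentiable_chartAt c).mdifferentiableAt hyc).comp y
    ((mdifferentiable_chartAt b).symm.mdifferentiableAt hy)
  exact h1.differentiableAt.hasFDerivAt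

/-- Chain rule for `(chartAt b).symm = (chartAt c).symm ∘ transition b c` near `y`. The vectors are
read in the model space since the base points on the two sides are only propositionally equal. -/
theorem coordVec_eq_sum {b c : M} {y : 𝔼} (hy : y ∈ (chartAt 𝔼 b).target)
    (hyc : (chartAt 𝔼 b).symm y ∈ (chartAt 𝔼 c).source) (i : Fin d) :
    (coordVec b y i : 𝔼) = ∑ k, (fderiv ℝ (transition b c) y (EuclideanSpace.single i (1 : ℝ))) k •
      (coordVec c (transition b c y) k : 𝔼) := by
  have hτ : transition b c y ∈ (chartAt 𝔼 c).target := (chartAt 𝔼 c).map_source hyc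
  have heq : (chartAt 𝔼 b).symm =ᶠ[𝓝 y] (chartAt 𝔼 c).symm ∘ transition b c := by
    have hmem : (chartAt 𝔼 b).symm ⁻¹' (chartAt 𝔼 c).source ∈ 𝓝 y :=
      ((chartAt 𝔼 b).continuousAt_symm hy).preimage_mem_nhds
        ((chartAt 𝔼 c).open_source.mem_nhds hyc)
    filter_upwards [hmem] with z hz
    exact ((chartAt 𝔼 c).left_inv hz).symm
  have h1 := heq.mfderiv_eq (I := 𝓡 d) (I' := 𝓡 d)
  have h2 := mfderiv_comp y ((mdifferentiable_chartAt c).symm.mdifferentiableAt hτ)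
    (hasFDerivAt_transition hy hyc).differentiableAt.mdifferentiableAt
  have h3 : (coordVec b y i : 𝔼) =
      (mfderiv (𝓡 d) (𝓡 d) (chartAt 𝔼 c).symm (transition b c y) : 𝔼 →L[ℝ] 𝔼)
        (fderiv ℝ (transition b c) y (EuclideanSpace.single i (1 : ℝ))) := by
    have h4 : (mfderiv (𝓡 d) (𝓡 d) (chartAt 𝔼 b).symm y : 𝔼 →L[ℝ] 𝔼) =
      (mfderiv (𝓡 d) (𝓡 d) (chartAt 𝔼 c).symm (transition b c y) : 𝔼 →L[ℝ] 𝔼).comp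
        (fderiv ℝ (transition b c) y) := by
      have h5 : (mfderiv (𝓡 d) (𝓡 d) (transition b c) y : 𝔼 →L[ℝ] 𝔼) =
        fderiv ℝ (transition b c) y := mfderiv_eq_fderiv
      exact (h1.trans h2).trans (congrArg (ContinuousLinearMap.comp
        (mfderiv (𝓡 d) (𝓡 d) (chartAt 𝔼 c).symm (transition b c y) : 𝔼 →L[ℝ] 𝔼)) h5)
    exact DFunLike.congr_fun h4 _
  exact h3.trans (clm_apply_eq_sum (mfderiv (𝓡 d) (𝓡 d) (chartAt 𝔼 c).symm (transition b c y)) _)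

variable [RiemannianBundle (fun x : M ↦ TangentSpace (𝓡 d) x)]

theorem metricMatrix_eq_gram (c : M) {y : 𝔼} (hy : y ∈ (chartAt 𝔼 c).target) :
    metricMatrix c y = Matrix.gram ℝ (coordBasis c hy) := by
  rw [coe_coordBasis]; rfl

theorem det_metricMatrix_pos (c : M) {y : 𝔼} (hy : y ∈ (chartAt 𝔼 c).target) :
    0 < (metricMatrix c y).det := by
  rw [metricMatrix_eq_gram c hy]
  exact (Matrix.posDef_gram_of_linearIndependent (coordBasis c hy).linearIndependent).det_pos

theorem volDensity_pos (c : M) {y : 𝔼} (hy : y ∈ (chartAt 𝔼 c).target) : 0 < volDensity c y :=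
  Real.sqrt_pos.2 (det_metricMatrix_pos c hy)

omit [IsManifold (𝓡 d) ∞ M] in
theorem inner_grad_left (f : M → ℝ) (x : M) (w : TangentSpace (𝓡 d) x) :
    inner ℝ (grad f x) w = mfderiv (𝓡 d) 𝓘(ℝ, ℝ) f x w := by
  have : FiniteDimensional ℝ (TangentSpace (𝓡 d) x) :=
    inferInstanceAs (FiniteDimensional ℝ (EuclideanSpace ℝ (Fin d)))
  have : CompleteSpace (TangentSpace (𝓡 d) x) :=
    FiniteDimensional.complete ℝ (TangentSpace (𝓡 d) x)
  exact InnerProductSpace.toDual_symm_apply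

/-- The coordinate expression of `g(∇f, ∇h)`. -/
theorem inner_grad_grad {f h : M → ℝ} (hf : ContMDiff (𝓡 d) 𝓘(ℝ, ℝ) ∞ f)
    (hh : ContMDiff (𝓡 d) 𝓘(ℝ, ℝ) ∞ h) (c : M) {y : 𝔼} (hy : y ∈ (chartAt 𝔼 c).target) :
    inner ℝ (grad (d := d) f ((chartAt 𝔼 c).symm y)) (grad h ((chartAt 𝔼 c).symm y)) =
      ∑ i, ∑ j, (metricMatrix c y)⁻¹ i j *
        fderiv ℝ (fun z ↦ f ((chartAt 𝔼 c).symm z)) y (EuclideanSpace.single j (1 : ℝ)) *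
        fderiv ℝ (fun z ↦ h ((chartAt 𝔼 c).symm z)) y (EuclideanSpace.single i (1 : ℝ)) := by
  rw [real_inner_comm, inner_eq_sum_gram_inv (coordBasis c hy), ← metricMatrix_eq_gram c hy]
  simp only [inner_grad_left, coe_coordBasis, mfderiv_coordVec hf c hy, mfderiv_coordVec hh c hy]

/-- The metric as a bilinear form on the model space. -/
def metricForm (x : M) (p q : 𝔼) : ℝ :=
  @inner ℝ (TangentSpace (𝓡 d) x) _ p q

omit [IsManifold (𝓡 d) ∞ M] in
theorem metricForm_sum_sum {ι : Type*} (s : Finset ι) (x : M) (a b : ι → ℝ) (p : ι → 𝔼) :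
    metricForm x (∑ k ∈ s, a k • p k) (∑ l ∈ s, b l • p l) =
      ∑ k ∈ s, ∑ l ∈ s, a k * (metricForm x (p k) (p l) * b l) := by
  have h : ∀ p q : TangentSpace (𝓡 d) x, metricForm x p q = inner ℝ p q := fun _ _ ↦ rfl
  have := sum_inner (𝕜 := ℝ) (E := TangentSpace (𝓡 d) x) s (fun k ↦ a k • p k)
    (∑ l ∈ s, b l • p l)
  refine this.trans (Finset.sum_congr rfl fun k _ ↦ ?_)
  refine (inner_sum (𝕜 := ℝ) (E := TangentSpace (𝓡 d) x) s (fun l ↦ b l • p l) _).trans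
    (Finset.sum_congr rfl fun l _ ↦ ?_)
  refine (real_inner_smul_left (F := TangentSpace (𝓡 d) x) _ _ _).trans ?_
  congr 1
  refine (real_inner_smul_right (F := TangentSpace (𝓡 d) x) _ _ _).trans ?_
  rw [mul_comm]; rfl

theorem metricMatrix_transition {b c : M} {y : 𝔼} (hy : y ∈ (chartAt 𝔼 b).target)
    (hyc : (chartAt 𝔼 b).symm y ∈ (chartAt 𝔼 c).source) :
    ∃ J : Matrix (Fin d) (Fin d) ℝ, J.det = (fderiv ℝ (transition b c) y).det ∧
      metricMatrix b y = J.transpose * metricMatrix c (transition b c y) * J := by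
  set e := (EuclideanSpace.basisFun (Fin d) ℝ).toBasis
  refine ⟨LinearMap.toMatrix e e (fderiv ℝ (transition b c) y).toLinearMap,
    LinearMap.det_toMatrix _ _, ?_⟩
  have hx : (chartAt 𝔼 c).symm (transition b c y) = (chartAt 𝔼 b).symm y :=
    (chartAt 𝔼 c).left_inv hyc
  have hJ : ∀ k i, LinearMap.toMatrix e e (fderiv ℝ (transition b c) y).toLinearMap k i =
      (fderiv ℝ (transition b c) y (EuclideanSpace.single i (1 : ℝ))) k := by
    intro k i
    simp [LinearMap.toMatrix_apply, e]
  have hm : ∀ (c : M) (z : 𝔼) k l, metricMatrix c z k l =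
      metricForm ((chartAt 𝔼 c).symm z) (coordVec c z k : 𝔼) (coordVec c z l : 𝔼) :=
    fun _ _ _ _ ↦ rfl
  ext i j
  rw [Matrix.mul_assoc, Matrix.mul_apply, hm]
  refine ((congrArg₂ (metricForm _) (coordVec_eq_sum hy hyc i) (coordVec_eq_sum hy hyc j)).trans
    (metricForm_sum_sum Finset.univ _ _ _ _)).trans (Finset.sum_congr rfl fun k _ ↦ ?_)
  rw [Matrix.mul_apply, Finset.mul_sum]
  refine Finset.sum_congr rfl fun l _ ↦ ?_
  rw [Matrix.transpose_apply, hJ, hJ, hm, hx]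

/-- Take determinants in `G_b = Jᵀ G_c J`: the Jacobian factor is exactly that of the change of
variables formula. -/
theorem volDensity_transition {b c : M} {y : 𝔼} (hy : y ∈ (chartAt 𝔼 b).target)
    (hyc : (chartAt 𝔼 b).symm y ∈ (chartAt 𝔼 c).source) :
    volDensity b y = |(fderiv ℝ (transition b c) y).det| * volDensity c (transition b c y) := by
  obtain ⟨J, hJ, h⟩ := metricMatrix_transition hy hyc
  rw [volDensity, volDensity, h, Matrix.det_mul, Matrix.det_mul, Matrix.det_transpose, hJ,
    mul_right_comm, Real.sqrt_mul (mul_self_nonneg _), Real.sqrt_mul_self_eq_abs]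

variable [IsContMDiffRiemannianBundle (𝓡 d) ∞ (EuclideanSpace ℝ (Fin d))
  (fun x : M ↦ TangentSpace (𝓡 d) x)]

theorem contDiffOn_metricMatrix (c : M) (i j : Fin d) :
    ContDiffOn ℝ ∞ (fun y ↦ metricMatrix c y i j) (chartAt 𝔼 c).target := by
  have h := ContMDiffOn.inner_bundle (IM := 𝓡 d) (IB := 𝓡 d) (F := 𝔼)
    (E := fun x : M ↦ TangentSpace (𝓡 d) x)
    (contMDiffOn_coordVec c i) (contMDiffOn_coordVec c j)
  exact h.contDiffOn

theorem contDiffOn_det_metricMatrix (c : M) :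
    ContDiffOn ℝ ∞ (fun y ↦ (metricMatrix c y).det) (chartAt 𝔼 c).target := by
  simp only [Matrix.det_apply]
  exact ContDiffOn.sum fun σ _ ↦ (contDiffOn_prod fun i _ ↦
    contDiffOn_metricMatrix c (σ i) i).const_smul _

theorem contDiffOn_volDensity (c : M) :
    ContDiffOn ℝ ∞ (fun y ↦ volDensity c y) (chartAt 𝔼 c).target :=
  (contDiffOn_det_metricMatrix c).sqrt fun _ hy ↦ (det_metricMatrix_pos c hy).ne'

/-- By Cramer's rule the inverse is the adjugate, polynomial in the entries, over a nonvanishing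
determinant. -/
theorem contDiffOn_metricMatrix_inv (c : M) (i j : Fin d) :
    ContDiffOn ℝ ∞ (fun y ↦ (metricMatrix c y)⁻¹ i j) (chartAt 𝔼 c).target := by
  have h : ContDiffOn ℝ ∞ (fun y ↦ (metricMatrix c y).adjugate i j) (chartAt 𝔼 c).target := by
    simp only [Matrix.adjugate_apply, Matrix.det_apply]
    refine ContDiffOn.sum fun σ _ ↦ (contDiffOn_prod fun k _ ↦ ?_).const_smul _
    by_cases hk : σ k = j
    · simp only [hk, Matrix.updateRow_self]
      exact contDiffOn_const
    · simp only [Matrix.updateRow_ne hk]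
      exact contDiffOn_metricMatrix c (σ k) k
  have h' := ((contDiffOn_det_metricMatrix c).inv fun _ hy ↦ (det_metricMatrix_pos c hy).ne').mul h
  refine h'.congr fun y hy ↦ ?_
  rw [Matrix.inv_def, Ring.inverse_eq_inv', Matrix.smul_apply, smul_eq_mul, Pi.inv_apply]

end ChartGeometry

/-! ### The Riemannian volume and its expression in charts. -/

theorem measurableSet_inter_preimage {X Y : Type*} [TopologicalSpace X] [MeasurableSpace X]
    [OpensMeasurableSpace X] [TopologicalSpace Y] [MeasurableSpace Y] [BorelSpace Y] {f : X → Y}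
    {s : Set X} (hf : ContinuousOn f s) (hs : MeasurableSet s) {E : Set Y} (hE : MeasurableSet E) :
    MeasurableSet (s ∩ f ⁻¹' E) := by
  have h : MeasurableSet ((fun x : s ↦ f x) ⁻¹' E) :=
    (continuousOn_iff_continuous_domRestrict.1 hf).measurable hE
  have h' := hs.subtype_image h
  convert h' using 1
  ext x
  simp [and_comm]

section Volume

variable {d : ℕ} {M : Type*} [TopologicalSpace M] [ChartedSpace (EuclideanSpace ℝ (Fin d)) M]

local notation "𝔼" => EuclideanSpace ℝ (Fin d)

theorem measurableSet_target (c : M) : MeasurableSet (chartAt 𝔼 c).target :=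
  (chartAt 𝔼 c).open_target.measurableSet

variable [MeasurableSpace M] [BorelSpace M]

theorem measurableSet_source (c : M) : MeasurableSet (chartAt 𝔼 c).source :=
  (chartAt 𝔼 c).open_source.measurableSet

theorem measurableSet_target_inter (c : M) {E : Set M} (hE : MeasurableSet E) :
    MeasurableSet ((chartAt 𝔼 c).target ∩ (chartAt 𝔼 c).symm ⁻¹' E) :=
  measurableSet_inter_preimage (chartAt 𝔼 c).continuousOn_symm (measurableSet_target c) hE

variable [RiemannianBundle (fun x : M ↦ TangentSpace (𝓡 d) x)]

/-- The measure `√(det g_{ij}) dy` on the target of a chart. -/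
def coordVolume (c : M) : Measure 𝔼 :=
  (volume.restrict (chartAt 𝔼 c).target).withDensity fun y ↦ ENNReal.ofReal (volDensity c y)

variable (d) in
/-- The Riemannian volume of the domain of a chart, transported from the target. -/
def chartVolume (c : M) : Measure M := Measure.map (chartAt 𝔼 c).symm (coordVolume c)

omit [BorelSpace M] in
variable (d M) in
theorem riemannianVolume_eq_iSup : riemannianVolume d M = ⨆ c : M, chartVolume d c := rfl

theorem aemeasurable_chart_symm (c : M) : AEMeasurable (chartAt 𝔼 c).symm (coordVolume c) :=
  ((chartAt 𝔼 c).continuousOn_symm.aemeasurable (measurableSet_target c)).mono_ac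
    (withDensity_absolutelyContinuous _ _)

theorem chartVolume_apply (c : M) {E : Set M} (hE : MeasurableSet E) :
    chartVolume d c E = ∫⁻ y in (chartAt 𝔼 c).target ∩ (chartAt 𝔼 c).symm ⁻¹' E,
      ENNReal.ofReal (volDensity c y) := by
  rw [chartVolume, Measure.map_apply_of_aemeasurable (aemeasurable_chart_symm c) hE, coordVolume,
    withDensity_apply', Measure.restrict_restrict' (measurableSet_target c), inter_comm]

variable [IsManifold (𝓡 d) ∞ M]

theorem chartVolume_eq_of_subset {b c : M} {E : Set M} (hE : MeasurableSet E)
    (hb : E ⊆ (chartAt 𝔼 b).source) (hc : E ⊆ (chartAt 𝔼 c).source) :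
    chartVolume d b E = chartVolume d c E := by
  rw [chartVolume_apply b hE, chartVolume_apply c hE]
  have himage : transition b c '' ((chartAt 𝔼 b).target ∩ (chartAt 𝔼 b).symm ⁻¹' E) =
      (chartAt 𝔼 c).target ∩ (chartAt 𝔼 c).symm ⁻¹' E := by
    ext z
    constructor
    · rintro ⟨y, ⟨_, hyE⟩, rfl⟩
      refine ⟨(chartAt 𝔼 c).map_source (hc hyE), ?_⟩
      rw [mem_preimage, transition, (chartAt 𝔼 c).left_inv (hc hyE)]
      exact hyE
    · rintro ⟨hz, hzE⟩
      refine ⟨chartAt 𝔼 b ((chartAt 𝔼 c).symm z), ⟨(chartAt 𝔼 b).map_source (hb hzE), ?_⟩, ?_⟩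
      · rw [mem_preimage, (chartAt 𝔼 b).left_inv (hb hzE)]
        exact hzE
      · rw [transition, (chartAt 𝔼 b).left_inv (hb hzE), (chartAt 𝔼 c).right_inv hz]
  have hinj : InjOn (transition b c) ((chartAt 𝔼 b).target ∩ (chartAt 𝔼 b).symm ⁻¹' E) := by
    intro y hy z hz h
    exact (chartAt 𝔼 b).symm.injOn hy.1 hz.1
      ((chartAt 𝔼 c).injOn (hc hy.2) (hc hz.2) h)
  rw [← himage, lintegral_image_eq_lintegral_abs_det_fderiv_mul volume
    (measurableSet_target_inter b hE)
    (fun y hy ↦ (hasFDerivAt_transition hy.1 (hc hy.2)).hasFDerivWithinAt) hinj]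
  refine setLIntegral_congr_fun (measurableSet_target_inter b hE) fun y hy ↦ ?_
  rw [volDensity_transition hy.1 (hc hy.2), ENNReal.ofReal_mul (abs_nonneg _)]

/-- The supremum is bounded by any common upper bound of the chart volumes. Such a bound is
`chartVolume d c` plus a measure that is infinite on every nonempty set outside the domain of `c`;
it adds nothing to `E`. -/
theorem riemannianVolume_apply (c : M) {E : Set M} (hE : MeasurableSet E)
    (hc : E ⊆ (chartAt 𝔼 c).source) : riemannianVolume d M E = chartVolume d c E := by
  refine le_antisymm ?_ (Measure.le_iff'.1 (le_iSup (fun c : M ↦ chartVolume d c) c) E)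
  set ν : Measure M :=
    chartVolume d c + ((⊤ : ℝ≥0∞) • Measure.count).restrict (chartAt 𝔼 c).sourceᶜ with hν
  have hle : riemannianVolume d M ≤ ν := by
    rw [riemannianVolume_eq_iSup]
    refine iSup_le fun b ↦ Measure.le_iff.2 fun s hs ↦ ?_
    rw [hν, Measure.add_apply, Measure.restrict_apply hs, Measure.smul_apply, smul_eq_mul]
    rcases (s ∩ (chartAt 𝔼 c).sourceᶜ).eq_empty_or_nonempty with h | h
    · have hsc : s ⊆ (chartAt 𝔼 c).source := by
        rwa [← Set.sdiff_eq, sdiff_eq_empty] at h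
      refine le_add_right ?_
      -- A chart volume does not charge the complement of its own domain, so only `s` within the
      -- overlap counts, where the volumes agree.
      have hsplit : ∀ a : M, chartVolume d a (s \ (chartAt 𝔼 a).source) = 0 := by
        intro a
        have hm := hs.diff (measurableSet_source (d := d) a)
        rw [chartVolume_apply a hm]
        have : (chartAt 𝔼 a).target ∩ (chartAt 𝔼 a).symm ⁻¹' (s \ (chartAt 𝔼 a).source) = ∅ := by
          ext y
          simp only [mem_inter_iff, mem_preimage, Set.mem_sdiff, mem_empty_iff_false, iff_false]
          exact fun hy ↦ hy.2.2 ((chartAt 𝔼 a).map_target hy.1)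
        rw [this, Measure.restrict_empty, lintegral_zero_measure]
      rw [← measure_inter_add_sdiff s (measurableSet_source (d := d) b), hsplit b, add_zero,
        chartVolume_eq_of_subset (hs.inter (measurableSet_source b)) inter_subset_right
          (inter_subset_left.trans hsc)]
      exact measure_mono inter_subset_left
    · have : (⊤ : ℝ≥0∞) * Measure.count (s ∩ (chartAt 𝔼 c).sourceᶜ) = ⊤ := by
        rw [ENNReal.top_mul]
        rw [Measure.count_ne_zero_iff]
        exact h
      rw [this, add_top]
      exact le_top
  refine (Measure.le_iff'.1 hle E).trans ?_
  rw [hν, Measure.add_apply, Measure.restrict_apply hE, ← Set.sdiff_eq,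
    sdiff_eq_empty.2 hc, measure_empty, add_zero]

theorem riemannianVolume_restrict_source (c : M) :
    (riemannianVolume d M).restrict (chartAt 𝔼 c).source = chartVolume d c := by
  ext s hs
  rw [Measure.restrict_apply hs, riemannianVolume_apply c (hs.inter (measurableSet_source c))
    inter_subset_right, chartVolume_apply c hs,
    chartVolume_apply c (hs.inter (measurableSet_source c))]
  congr 2
  ext y
  simp only [mem_inter_iff, mem_preimage]
  exact ⟨fun h ↦ ⟨h.1, h.2.1⟩, fun h ↦ ⟨h.1, h.2, (chartAt 𝔼 c).map_target h.1⟩⟩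

variable [IsContMDiffRiemannianBundle (𝓡 d) ∞ (EuclideanSpace ℝ (Fin d))
  (fun x : M ↦ TangentSpace (𝓡 d) x)]

omit [MeasurableSpace M] [BorelSpace M] in
theorem aemeasurable_volDensity (c : M) :
    AEMeasurable (volDensity c) (volume.restrict (chartAt 𝔼 c).target) :=
  (contDiffOn_volDensity c).continuousOn.aemeasurable (measurableSet_target c)

theorem setIntegral_source_riemannianVolume (c : M) {F : M → ℝ}
    (hF : AEStronglyMeasurable F ((riemannianVolume d M).restrict (chartAt 𝔼 c).source)) :
    ∫ x in (chartAt 𝔼 c).source, F x ∂riemannianVolume d M =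
      ∫ y in (chartAt 𝔼 c).target, volDensity c y * F ((chartAt 𝔼 c).symm y) := by
  rw [riemannianVolume_restrict_source] at hF ⊢
  rw [chartVolume, integral_map (aemeasurable_chart_symm c) hF, coordVolume,
    integral_withDensity_eq_integral_toReal_smul₀ (aemeasurable_volDensity c).ennreal_ofReal
      (ae_of_all _ fun _ ↦ ENNReal.ofReal_lt_top)]
  refine integral_congr_ae (ae_of_all _ fun y ↦ ?_)
  simp only [smul_eq_mul]
  rw [ENNReal.toReal_ofReal (show 0 ≤ volDensity c y from Real.sqrt_nonneg _)]

instance isLocallyFiniteMeasure_riemannianVolume :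
    IsLocallyFiniteMeasure (riemannianVolume d M) := by
  refine ⟨fun x ↦ ?_⟩
  obtain ⟨r, hr, hball⟩ := Metric.nhds_basis_closedBall.mem_iff.1
    ((chartAt 𝔼 x).open_target.mem_nhds (mem_chart_target 𝔼 x))
  set B := Metric.closedBall (chartAt 𝔼 x x) r
  set s := (chartAt 𝔼 x).source ∩ (chartAt 𝔼 x) ⁻¹' B
  have hs : s ∈ 𝓝 x := inter_mem ((chartAt 𝔼 x).open_source.mem_nhds (mem_chart_source 𝔼 x))
    (((chartAt 𝔼 x).continuousAt (mem_chart_source 𝔼 x)).preimage_mem_nhds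
      (Metric.closedBall_mem_nhds _ hr))
  have hsm : MeasurableSet s := measurableSet_inter_preimage (chartAt 𝔼 x).continuousOn
    (measurableSet_source x) Metric.isClosed_closedBall.measurableSet
  refine ⟨s, hs, ?_⟩
  rw [riemannianVolume_apply x hsm inter_subset_left, chartVolume_apply x hsm]
  have hsub : (chartAt 𝔼 x).target ∩ (chartAt 𝔼 x).symm ⁻¹' s ⊆ B := by
    rintro y ⟨hy, -, hyB⟩
    rwa [mem_preimage, (chartAt 𝔼 x).right_inv hy] at hyB
  have hint : IntegrableOn (volDensity x) B volume :=
    ((contDiffOn_volDensity x).continuousOn.mono hball).integrableOn_compact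
      (isCompact_closedBall _ _)
  exact (lintegral_mono_set hsub).trans_lt hint.lintegral_lt_top

/-- The density is positive. This later upgrades almost everywhere equality of continuous functions
to equality. -/
instance isOpenPosMeasure_riemannianVolume :
    Measure.IsOpenPosMeasure (riemannianVolume d M) := by
  refine ⟨fun U hU ⟨x, hx⟩ h0 ↦ ?_⟩
  have hUo : IsOpen (U ∩ (chartAt 𝔼 x).source) := hU.inter (chartAt 𝔼 x).open_source
  have h1 : riemannianVolume d M (U ∩ (chartAt 𝔼 x).source) = 0 :=
    measure_mono_null inter_subset_left h0
  have hAo : IsOpen ((chartAt 𝔼 x).target ∩ (chartAt 𝔼 x).symm ⁻¹'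
      (U ∩ (chartAt 𝔼 x).source)) := (chartAt 𝔼 x).isOpen_inter_preimage_symm hUo
  rw [riemannianVolume_apply x hUo.measurableSet inter_subset_right,
    chartVolume_apply x hUo.measurableSet, setLIntegral_eq_zero_iff' hAo.measurableSet
      (((aemeasurable_volDensity x).mono_measure
        (Measure.restrict_mono_set _ inter_subset_left)).ennreal_ofReal)] at h1
  refine hAo.measure_ne_zero volume ⟨chartAt 𝔼 x x, mem_chart_target 𝔼 x, ?_⟩ ?_
  · rw [mem_preimage, (chartAt 𝔼 x).left_inv (mem_chart_source 𝔼 x)]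
    exact ⟨hx, mem_chart_source 𝔼 x⟩
  · refine measure_mono_null (fun y hy ↦ ?_) (ae_iff.1 h1)
    rw [mem_ofPred]
    push Not
    exact ⟨hy, (ENNReal.ofReal_pos.2 (volDensity_pos x hy.1)).ne'⟩

end Volume

/-! ### The divergence theorem for compactly supported fields. -/

section Divergence

variable {E : Type*} [NormedAddCommGroup E] [NormedSpace ℝ E] [FiniteDimensional ℝ E]
  [MeasurableSpace E] [BorelSpace E] {μ : Measure E} [μ.IsAddHaarMeasure]

/-- Integration by parts against the constant function `1`. -/
theorem integral_fderiv_eq_zero {W : E → ℝ} (hW : ContDiff ℝ 1 W) (hc : HasCompactSupport W)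
    (e : E) : ∫ y, fderiv ℝ W y e ∂μ = 0 := by
  have hint : Integrable W μ := hW.continuous.integrable_of_hasCompactSupport hc
  have hint' : Integrable (fun y ↦ fderiv ℝ W y e) μ :=
    ((hW.continuous_fderiv one_ne_zero).clm_apply
      continuous_const).integrable_of_hasCompactSupport (hc.fderiv_apply ℝ e)
  have h := integral_mul_fderiv_eq_neg_fderiv_mul_of_integrable (μ := μ) (f := fun _ : E ↦ (1 : ℝ))
    (g := W) (v := e) (by simp) (by simpa using hint') (by simpa using hint)
    (fun _ _ ↦ differentiableAt_const _) (fun _ _ ↦ hW.differentiable one_ne_zero _)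
  simpa using h

/-- Extension by zero is `C¹` on the whole space because `W` vanishes off a compact subset of `U`.
-/
theorem setIntegral_fderiv_eq_zero {W : E → ℝ} {U K : Set E} (hU : IsOpen U) (hK : IsCompact K)
    (hKU : K ⊆ U) (hW : ContDiffOn ℝ 1 W U) (hW0 : ∀ y ∈ U, y ∉ K → W y = 0) (e : E) :
    IntegrableOn (fun y ↦ fderiv ℝ W y e) U μ ∧ ∫ y in U, fderiv ℝ W y e ∂μ = 0 := by
  set V : E → ℝ := U.indicator W
  have hVU : ∀ y ∈ U, V =ᶠ[𝓝 y] W := fun y hy ↦ by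
    filter_upwards [hU.mem_nhds hy] with z hz using indicator_of_mem hz W
  have hV0 : ∀ y, y ∉ K → V y = 0 := fun y hy ↦ by
    by_cases hyU : y ∈ U
    · rw [show V y = W y from indicator_of_mem hyU W, hW0 y hyU hy]
    · exact indicator_of_notMem hyU W
  have hVc : HasCompactSupport V := HasCompactSupport.intro hK hV0
  have hV : ContDiff ℝ 1 V := by
    rw [contDiff_iff_contDiffAt]
    intro y
    by_cases hy : y ∈ K
    · exact (hW.contDiffAt (hU.mem_nhds (hKU hy))).congr_of_eventuallyEq (hVU y (hKU hy))
    · refine contDiffAt_const (c := (0 : ℝ)) |>.congr_of_eventuallyEq ?_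
      filter_upwards [hK.isClosed.isOpen_compl.mem_nhds hy] with z hz using hV0 z hz
  have heq : ∀ y ∈ U, fderiv ℝ V y e = fderiv ℝ W y e := fun y hy ↦ by
    rw [(hVU y hy).fderiv_eq]
  have hout : ∀ y, y ∉ U → fderiv ℝ V y e = 0 := fun y hy ↦ by
    have : V =ᶠ[𝓝 y] fun _ ↦ 0 := by
      filter_upwards [hK.isClosed.isOpen_compl.mem_nhds fun h ↦ hy (hKU h)] with z hz using hV0 z hz
    rw [this.fderiv_eq]
    simp
  have hint : Integrable (fun y ↦ fderiv ℝ V y e) μ :=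
    ((hV.continuous_fderiv one_ne_zero).clm_apply
      continuous_const).integrable_of_hasCompactSupport (hVc.fderiv_apply ℝ e)
  refine ⟨hint.integrableOn.congr_fun heq hU.measurableSet, ?_⟩
  rw [← setIntegral_congr_fun hU.measurableSet heq,
    setIntegral_eq_integral_of_forall_compl_eq_zero hout, integral_fderiv_eq_zero hV hVc]

end Divergence

/-! ### Green's formula in one chart and invariance of the Laplacian. -/

section LocalGreen

variable {d : ℕ} {M : Type*} [TopologicalSpace M] [ChartedSpace (EuclideanSpace ℝ (Fin d)) M]

local notation "𝔼" => EuclideanSpace ℝ (Fin d)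

theorem mfderiv_of_notMem_tsupport {h : M → ℝ} {x : M} (hx : x ∉ tsupport h) :
    mfderiv (𝓡 d) 𝓘(ℝ, ℝ) h x = 0 := by
  have : h =ᶠ[𝓝 x] fun _ ↦ 0 := notMem_tsupport_iff_eventuallyEq.1 hx
  rw [this.mfderiv_eq]
  exact mfderiv_const

variable [IsManifold (𝓡 d) ∞ M]

theorem contDiffOn_fderiv_comp_chart_symm {F : Type*} [NormedAddCommGroup F] [NormedSpace ℝ F]
    {f : M → F} (hf : ContMDiff (𝓡 d) 𝓘(ℝ, F) ∞ f) (c : M) (e : 𝔼) :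
    ContDiffOn ℝ ∞ (fun y ↦ fderiv ℝ (fun z ↦ f ((chartAt 𝔼 c).symm z)) y e)
      (chartAt 𝔼 c).target :=
  ((contDiffOn_comp_chart_symm hf c).fderiv_of_isOpen (m := ∞) (chartAt 𝔼 c).open_target
    le_rfl).clm_apply contDiffOn_const

variable [RiemannianBundle (fun x : M ↦ TangentSpace (𝓡 d) x)]

/-- The flux `(det g)^{1/2} g^{ij} ∂ⱼf` of the gradient in the chart centred at `c`. -/
def coordFlux (c : M) (f : M → ℝ) (i j : Fin d) (y : 𝔼) : ℝ :=
  volDensity c y * (metricMatrix c y)⁻¹ i j *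
    fderiv ℝ (fun z ↦ f ((chartAt 𝔼 c).symm z)) y (EuclideanSpace.single j (1 : ℝ))

/-- The Laplace-Beltrami operator on real functions, computed in the chart centred at `c`. -/
def coordLaplace (c : M) (f : M → ℝ) (y : 𝔼) : ℝ :=
  (volDensity c y)⁻¹ *
    ∑ i, ∑ j, fderiv ℝ (coordFlux c f i j) y (EuclideanSpace.single i (1 : ℝ))

omit [IsManifold (𝓡 d) ∞ M] in
theorem inner_grad_eq_zero {f h : M → ℝ} {x : M} (hx : x ∉ tsupport h) :
    inner ℝ (grad (d := d) f x) (grad h x) = 0 := by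
  rw [real_inner_comm, inner_grad_left, mfderiv_of_notMem_tsupport hx]
  rfl

variable [IsContMDiffRiemannianBundle (𝓡 d) ∞ (EuclideanSpace ℝ (Fin d))
  (fun x : M ↦ TangentSpace (𝓡 d) x)]

theorem contDiffOn_coordFlux {f : M → ℝ} (hf : ContMDiff (𝓡 d) 𝓘(ℝ, ℝ) ∞ f) (c : M)
    (i j : Fin d) : ContDiffOn ℝ ∞ (coordFlux c f i j) (chartAt 𝔼 c).target :=
  ((contDiffOn_volDensity c).mul (contDiffOn_metricMatrix_inv c i j)).mul
    (contDiffOn_fderiv_comp_chart_symm hf c _)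

theorem continuousOn_coordLaplace {f : M → ℝ} (hf : ContMDiff (𝓡 d) 𝓘(ℝ, ℝ) ∞ f) (c : M) :
    ContinuousOn (coordLaplace c f) (chartAt 𝔼 c).target := by
  refine ((contDiffOn_volDensity c).continuousOn.inv₀ fun y hy ↦ (volDensity_pos c hy).ne').mul ?_
  refine continuousOn_finsetSum _ fun i _ ↦ continuousOn_finsetSum _ fun j _ ↦ ?_
  exact (((contDiffOn_coordFlux hf c i j).fderiv_of_isOpen (m := ∞) (chartAt 𝔼 c).open_target
    le_rfl).clm_apply contDiffOn_const).continuousOn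

theorem continuousOn_coordLaplace_chart {f : M → ℝ} (hf : ContMDiff (𝓡 d) 𝓘(ℝ, ℝ) ∞ f) (c : M) :
    ContinuousOn (fun x ↦ coordLaplace c f (chartAt 𝔼 c x)) (chartAt 𝔼 c).source :=
  (continuousOn_coordLaplace hf c).comp (chartAt 𝔼 c).continuousOn
    fun _ hx ↦ (chartAt 𝔼 c).map_source hx

theorem continuous_inner_grad {f h : M → ℝ} (hf : ContMDiff (𝓡 d) 𝓘(ℝ, ℝ) ∞ f)
    (hh : ContMDiff (𝓡 d) 𝓘(ℝ, ℝ) ∞ h) :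
    Continuous fun x ↦ inner ℝ (grad (d := d) f x) (grad h x) := by
  rw [continuous_iff_continuousAt]
  intro c
  have h1 : ContinuousOn (fun y ↦ ∑ i, ∑ j, (metricMatrix c y)⁻¹ i j *
        fderiv ℝ (fun z ↦ f ((chartAt 𝔼 c).symm z)) y (EuclideanSpace.single j (1 : ℝ)) *
        fderiv ℝ (fun z ↦ h ((chartAt 𝔼 c).symm z)) y (EuclideanSpace.single i (1 : ℝ)))
      (chartAt 𝔼 c).target := by
    refine continuousOn_finsetSum _ fun i _ ↦ continuousOn_finsetSum _ fun j _ ↦ ?_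
    exact (((contDiffOn_metricMatrix_inv c i j).mul
      (contDiffOn_fderiv_comp_chart_symm hf c _)).mul
      (contDiffOn_fderiv_comp_chart_symm hh c _)).continuousOn
  have h2 := h1.comp (chartAt 𝔼 c).continuousOn fun _ hx ↦ (chartAt 𝔼 c).map_source hx
  refine (h2.congr fun x hx ↦ ?_).continuousAt
    ((chartAt 𝔼 c).open_source.mem_nhds (mem_chart_source 𝔼 c))
  have h3 := inner_grad_grad hf hh c ((chartAt 𝔼 c).map_source hx)
  rw [(chartAt 𝔼 c).left_inv hx] at h3
  exact h3

theorem continuous_mul_coordLaplace {f h : M → ℝ} (hf : ContMDiff (𝓡 d) 𝓘(ℝ, ℝ) ∞ f)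
    (hh : Continuous h) {c : M} (hc : tsupport h ⊆ (chartAt 𝔼 c).source) :
    Continuous fun x ↦ h x * coordLaplace c f (chartAt 𝔼 c x) := by
  rw [continuous_iff_continuousAt]
  intro x
  by_cases hx : x ∈ tsupport h
  · exact hh.continuousAt.mul ((continuousOn_coordLaplace_chart hf c).continuousAt
      ((chartAt 𝔼 c).open_source.mem_nhds (hc hx)))
  · refine (continuousAt_const (y := (0 : ℝ))).congr ?_
    filter_upwards [notMem_tsupport_iff_eventuallyEq.1 hx] with z hz
    rw [hz, Pi.zero_apply, zero_mul]

/-- Leibniz rule: in coordinates, the Green integrand times the density is the divergence of `h`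
times the flux of `∇f`. -/
theorem volDensity_mul_green {f h : M → ℝ} (hf : ContMDiff (𝓡 d) 𝓘(ℝ, ℝ) ∞ f)
    (hh : ContMDiff (𝓡 d) 𝓘(ℝ, ℝ) ∞ h) (c : M) {y : 𝔼} (hy : y ∈ (chartAt 𝔼 c).target) :
    volDensity c y * (h ((chartAt 𝔼 c).symm y) * coordLaplace c f y +
        inner ℝ (grad (d := d) f ((chartAt 𝔼 c).symm y)) (grad h ((chartAt 𝔼 c).symm y))) =
      ∑ i, ∑ j, fderiv ℝ (fun z ↦ h ((chartAt 𝔼 c).symm z) * coordFlux c f i j z) y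
        (EuclideanSpace.single i (1 : ℝ)) := by
  have hnhds := (chartAt 𝔼 c).open_target.mem_nhds hy
  have hhd : DifferentiableAt ℝ (fun z ↦ h ((chartAt 𝔼 c).symm z)) y :=
    ((contDiffOn_comp_chart_symm hh c).contDiffAt hnhds).differentiableAt (by simp)
  have hfd : ∀ i j, DifferentiableAt ℝ (coordFlux c f i j) y := fun i j ↦
    ((contDiffOn_coordFlux hf c i j).contDiffAt hnhds).differentiableAt (by simp)
  have hv := (volDensity_pos c hy).ne'
  rw [inner_grad_grad hf hh c hy, mul_add, coordLaplace, mul_left_comm, mul_inv_cancel_left₀ hv,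
    Finset.mul_sum, Finset.mul_sum, ← Finset.sum_add_distrib]
  refine Finset.sum_congr rfl fun i _ ↦ ?_
  rw [Finset.mul_sum, Finset.mul_sum, ← Finset.sum_add_distrib]
  refine Finset.sum_congr rfl fun j _ ↦ ?_
  rw [fderiv_fun_mul hhd (hfd i j)]
  simp only [_root_.add_apply, _root_.smul_apply, smul_eq_mul]
  rw [show coordFlux c f i j y = volDensity c y * (metricMatrix c y)⁻¹ i j *
    fderiv ℝ (fun z ↦ f ((chartAt 𝔼 c).symm z)) y (EuclideanSpace.single j (1 : ℝ)) from rfl]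
  ring

variable [CompactSpace M] [MeasurableSpace M] [BorelSpace M]

theorem integral_green_of_tsupport_subset {f h : M → ℝ} (hf : ContMDiff (𝓡 d) 𝓘(ℝ, ℝ) ∞ f)
    (hh : ContMDiff (𝓡 d) 𝓘(ℝ, ℝ) ∞ h) {c : M} (hc : tsupport h ⊆ (chartAt 𝔼 c).source) :
    ∫ x, (h x * coordLaplace c f (chartAt 𝔼 c x) + inner ℝ (grad (d := d) f x) (grad h x))
      ∂riemannianVolume d M = 0 := by
  have hcont : Continuous fun x ↦ h x * coordLaplace c f (chartAt 𝔼 c x) +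
      inner ℝ (grad (d := d) f x) (grad h x) :=
    (continuous_mul_coordLaplace hf hh.continuous hc).add (continuous_inner_grad hf hh)
  have hK : IsCompact (chartAt 𝔼 c '' tsupport h) :=
    (isClosed_tsupport h).isCompact.image_of_continuousOn ((chartAt 𝔼 c).continuousOn.mono hc)
  have hKU : chartAt 𝔼 c '' tsupport h ⊆ (chartAt 𝔼 c).target := by
    rintro _ ⟨x, hx, rfl⟩
    exact (chartAt 𝔼 c).map_source (hc hx)
  have hflux : ∀ i j, _ ∧ _ := fun i j ↦ setIntegral_fderiv_eq_zero (μ := volume)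
    (W := fun z ↦ h ((chartAt 𝔼 c).symm z) * coordFlux c f i j z)
    (chartAt 𝔼 c).open_target hK hKU
    (((contDiffOn_comp_chart_symm hh c).mul (contDiffOn_coordFlux hf c i j)).of_le
      (by norm_cast))
    (fun y hy hyK ↦ by
      have : h ((chartAt 𝔼 c).symm y) = 0 := image_eq_zero_of_notMem_tsupport fun hm ↦
        hyK ⟨_, hm, (chartAt 𝔼 c).right_inv hy⟩
      rw [this, zero_mul])
    (EuclideanSpace.single i (1 : ℝ))
  rw [← setIntegral_eq_integral_of_forall_compl_eq_zero (s := (chartAt 𝔼 c).source) fun x hx ↦ ?_,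
    setIntegral_source_riemannianVolume c hcont.aestronglyMeasurable]
  · have : ∀ y ∈ (chartAt 𝔼 c).target, volDensity c y *
        (h ((chartAt 𝔼 c).symm y) * coordLaplace c f (chartAt 𝔼 c ((chartAt 𝔼 c).symm y)) +
          inner ℝ (grad (d := d) f ((chartAt 𝔼 c).symm y)) (grad h ((chartAt 𝔼 c).symm y))) =
        ∑ i, ∑ j, fderiv ℝ (fun z ↦ h ((chartAt 𝔼 c).symm z) * coordFlux c f i j z) y
          (EuclideanSpace.single i (1 : ℝ)) := fun y hy ↦ by
      rw [(chartAt 𝔼 c).right_inv hy, volDensity_mul_green hf hh c hy]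
    rw [setIntegral_congr_fun (measurableSet_target c) this,
      integral_finsetSum _ fun i _ ↦ integrable_finsetSum _ fun j _ ↦ (hflux i j).1]
    refine Finset.sum_eq_zero fun i _ ↦ ?_
    rw [integral_finsetSum _ fun j _ ↦ (hflux i j).1]
    exact Finset.sum_eq_zero fun j _ ↦ (hflux i j).2
  · have hx' : x ∉ tsupport h := fun hm ↦ hx (hc hm)
    rw [inner_grad_eq_zero hx', image_eq_zero_of_notMem_tsupport hx', zero_mul, add_zero]

variable (d) in
theorem integrable_riemannianVolume_of_continuous {F : Type*} [NormedAddCommGroup F] {f : M → F}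
    (hf : Continuous f) : Integrable f (riemannianVolume d M) :=
  hf.integrable_of_hasCompactSupport (HasCompactSupport.of_compactSpace f)

variable [T2Space M]

/-- The coordinate expressions of the Laplace-Beltrami operator in two charts agree. -/
theorem coordLaplace_eq {f : M → ℝ} (hf : ContMDiff (𝓡 d) 𝓘(ℝ, ℝ) ∞ f) {b c x : M}
    (hb : x ∈ (chartAt 𝔼 b).source) (hc : x ∈ (chartAt 𝔼 c).source) :
    coordLaplace b f (chartAt 𝔼 b x) = coordLaplace c f (chartAt 𝔼 c x) := by
  set U := (chartAt 𝔼 b).source ∩ (chartAt 𝔼 c).source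
  have hU : IsOpen U := (chartAt 𝔼 b).open_source.inter (chartAt 𝔼 c).open_source
  have hcb := (continuousOn_coordLaplace_chart hf b).mono (inter_subset_left : U ⊆ _)
  have hcc := (continuousOn_coordLaplace_chart hf c).mono (inter_subset_right : U ⊆ _)
  -- No change of variables in second derivatives: both expressions satisfy Green's formula against
  -- every test function supported in the overlap, so their difference is orthogonal to all of them.
  have hae := hU.ae_eq_zero_of_integral_contMDiff_smul_eq_zero (𝓡 d)
    (μ := riemannianVolume d M)
    (f := fun x ↦ coordLaplace b f (chartAt 𝔼 b x) - coordLaplace c f (chartAt 𝔼 c x))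
    ((hcb.sub hcc).locallyIntegrableOn hU.measurableSet) (fun h hh _ hsupp ↦ by
      have hib := (continuous_mul_coordLaplace hf hh.continuous
        (hsupp.trans inter_subset_left)).add (continuous_inner_grad hf hh)
      have hic := (continuous_mul_coordLaplace hf hh.continuous
        (hsupp.trans inter_subset_right)).add (continuous_inner_grad hf hh)
      have h3 := integral_sub (integrable_riemannianVolume_of_continuous d hib)
        (integrable_riemannianVolume_of_continuous d hic)
      simp only [Pi.add_apply] at h3
      rw [integral_green_of_tsupport_subset hf hh (hsupp.trans inter_subset_left),
        integral_green_of_tsupport_subset hf hh (hsupp.trans inter_subset_right), sub_zero] at h3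
      rw [← h3]
      refine integral_congr_ae (ae_of_all _ fun x ↦ ?_)
      simp only [smul_eq_mul]
      ring)
  refine Measure.eqOn_open_of_ae_eq (μ := riemannianVolume d M) ?_ hU hcb hcc ⟨hb, hc⟩
  rw [EventuallyEq, ae_restrict_iff' hU.measurableSet]
  filter_upwards [hae] with x hx hxU using sub_eq_zero.1 (hx hxU)

end LocalGreen

/-! ### Green's formula on the whole manifold. -/

section GlobalGreen

variable {d : ℕ} {M : Type*} [TopologicalSpace M] [ChartedSpace (EuclideanSpace ℝ (Fin d)) M]

local notation "𝔼" => EuclideanSpace ℝ (Fin d)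

theorem contMDiff_re {F : M → ℂ} (hF : ContMDiff (𝓡 d) 𝓘(ℝ, ℂ) ∞ F) :
    ContMDiff (𝓡 d) 𝓘(ℝ, ℝ) ∞ fun x ↦ (F x).re :=
  Complex.reCLM.contDiff.contMDiff.comp hF

theorem contMDiff_im {F : M → ℂ} (hF : ContMDiff (𝓡 d) 𝓘(ℝ, ℂ) ∞ F) :
    ContMDiff (𝓡 d) 𝓘(ℝ, ℝ) ∞ fun x ↦ (F x).im :=
  Complex.imCLM.contDiff.contMDiff.comp hF

variable [RiemannianBundle (fun x : M ↦ TangentSpace (𝓡 d) x)]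

variable (d) in
/-- The Laplace-Beltrami operator on real functions. -/
def realLaplace (f : M → ℝ) (x : M) : ℝ := coordLaplace x f (chartAt 𝔼 x x)

theorem inner_grad_add {f h₁ h₂ : M → ℝ} (hh₁ : ContMDiff (𝓡 d) 𝓘(ℝ, ℝ) ∞ h₁)
    (hh₂ : ContMDiff (𝓡 d) 𝓘(ℝ, ℝ) ∞ h₂) (x : M) :
    inner ℝ (grad (d := d) f x) (grad (fun z ↦ h₁ z + h₂ z) x) =
      inner ℝ (grad (d := d) f x) (grad h₁ x) + inner ℝ (grad (d := d) f x) (grad h₂ x) := by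
  rw [real_inner_comm, real_inner_comm (grad h₁ x), real_inner_comm (grad h₂ x)]
  simp only [inner_grad_left]
  have h := mfderiv_add (hh₁.mdifferentiable (by simp) x) (hh₂.mdifferentiable (by simp) x)
  exact DFunLike.congr_fun h (grad f x)

theorem inner_complexGrad (F H : M → ℂ) (x : M) :
    inner ℝ (complexGrad (d := d) F x) (complexGrad H x) =
      inner ℝ (grad (d := d) (fun z ↦ (F z).re) x) (grad (fun z ↦ (H z).re) x) +
        inner ℝ (grad (d := d) (fun z ↦ (F z).im) x) (grad (fun z ↦ (H z).im) x) :=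
  WithLp.prod_inner_apply _ _

variable [IsManifold (𝓡 d) ∞ M] [IsContMDiffRiemannianBundle (𝓡 d) ∞ (EuclideanSpace ℝ (Fin d))
  (fun x : M ↦ TangentSpace (𝓡 d) x)]

/-- The Laplace-Beltrami operator commutes with real linear functionals of the values. -/
theorem apply_laplaceBeltrami {F : M → ℂ} (hF : ContMDiff (𝓡 d) 𝓘(ℝ, ℂ) ∞ F) (ℓ : ℂ →L[ℝ] ℝ)
    (x : M) : ℓ (laplaceBeltrami (d := d) F x) = realLaplace d (fun z ↦ ℓ (F z)) x := by
  have hmul : ∀ (a : ℝ) (z : ℂ), ℓ ((a : ℂ) * z) = a * ℓ z := fun a z ↦ by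
    rw [← Complex.real_smul, map_smul, smul_eq_mul]
  have hx := mem_chart_target 𝔼 x
  have hopen := (chartAt 𝔼 x).open_target
  rw [laplaceBeltrami, hmul, realLaplace, coordLaplace, map_sum]
  congr 1
  refine Finset.sum_congr rfl fun i _ ↦ ?_
  rw [map_sum]
  refine Finset.sum_congr rfl fun j _ ↦ ?_
  have hd : DifferentiableAt ℝ
      (fun y ↦ ((volDensity x y * (metricMatrix x y)⁻¹ i j : ℝ) : ℂ) *
        fderiv ℝ (fun z ↦ F ((chartAt 𝔼 x).symm z)) y (EuclideanSpace.single j (1 : ℝ)))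
      (chartAt 𝔼 x x) := by
    have h := ((contDiffOn_volDensity x).mul (contDiffOn_metricMatrix_inv x i j)).smul
      (contDiffOn_fderiv_comp_chart_symm hF x (EuclideanSpace.single j (1 : ℝ)))
    have h' := (h.contDiffAt (hopen.mem_nhds hx)).differentiableAt (by simp)
    refine h'.congr_of_eventuallyEq (Eventually.of_forall fun y ↦ ?_)
    simp only [Pi.smul_apply', Complex.real_smul]
  have h1 := (ℓ.hasFDerivAt.comp (chartAt 𝔼 x x) hd.hasFDerivAt).fderiv
  have h2 := DFunLike.congr_fun h1 (EuclideanSpace.single i (1 : ℝ))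
  refine h2.symm.trans ?_
  refine DFunLike.congr_fun (Filter.EventuallyEq.fderiv_eq ?_) _
  filter_upwards [hopen.mem_nhds hx] with y hy
  have hFd : DifferentiableAt ℝ (fun z ↦ F ((chartAt 𝔼 x).symm z)) y :=
    ((contDiffOn_comp_chart_symm hF x).contDiffAt (hopen.mem_nhds hy)).differentiableAt (by simp)
  have h3 := (ℓ.hasFDerivAt.comp y hFd.hasFDerivAt).fderiv
  simp only [Function.comp_apply, hmul, coordFlux]
  congr 1
  exact (DFunLike.congr_fun h3 (EuclideanSpace.single j (1 : ℝ))).symm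

theorem laplaceBeltrami_eq {F : M → ℂ} (hF : ContMDiff (𝓡 d) 𝓘(ℝ, ℂ) ∞ F) (x : M) :
    laplaceBeltrami (d := d) F x =
      ⟨realLaplace d (fun z ↦ (F z).re) x, realLaplace d (fun z ↦ (F z).im) x⟩ :=
  Complex.ext (apply_laplaceBeltrami hF Complex.reCLM x) (apply_laplaceBeltrami hF Complex.imCLM x)

theorem continuous_inner_complexGrad {F H : M → ℂ} (hF : ContMDiff (𝓡 d) 𝓘(ℝ, ℂ) ∞ F)
    (hH : ContMDiff (𝓡 d) 𝓘(ℝ, ℂ) ∞ H) :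
    Continuous fun x ↦ inner ℝ (complexGrad (d := d) F x) (complexGrad H x) := by
  simp only [inner_complexGrad]
  exact (continuous_inner_grad (contMDiff_re hF) (contMDiff_re hH)).add
    (continuous_inner_grad (contMDiff_im hF) (contMDiff_im hH))

theorem continuous_norm_complexGrad {F : M → ℂ} (hF : ContMDiff (𝓡 d) 𝓘(ℝ, ℂ) ∞ F) :
    Continuous fun x ↦ ‖complexGrad (d := d) F x‖ := by
  have := (continuous_inner_complexGrad hF hF).sqrt
  simpa only [real_inner_self_eq_norm_sq, Real.sqrt_sq (norm_nonneg _)] using this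

variable [CompactSpace M] [MeasurableSpace M] [BorelSpace M] [T2Space M]

theorem realLaplace_eq {f : M → ℝ} (hf : ContMDiff (𝓡 d) 𝓘(ℝ, ℝ) ∞ f) {c x : M}
    (hc : x ∈ (chartAt 𝔼 c).source) :
    realLaplace d f x = coordLaplace c f (chartAt 𝔼 c x) :=
  coordLaplace_eq hf (mem_chart_source 𝔼 x) hc

theorem continuous_realLaplace {f : M → ℝ} (hf : ContMDiff (𝓡 d) 𝓘(ℝ, ℝ) ∞ f) :
    Continuous (realLaplace d f) := by
  rw [continuous_iff_continuousAt]
  intro c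
  exact ((continuousOn_coordLaplace_chart hf c).congr fun x hx ↦ realLaplace_eq hf hx).continuousAt
    ((chartAt 𝔼 c).open_source.mem_nhds (mem_chart_source 𝔼 c))

theorem continuous_green {f h : M → ℝ} (hf : ContMDiff (𝓡 d) 𝓘(ℝ, ℝ) ∞ f)
    (hh : ContMDiff (𝓡 d) 𝓘(ℝ, ℝ) ∞ h) :
    Continuous fun x ↦ h x * realLaplace d f x + inner ℝ (grad (d := d) f x) (grad h x) :=
  (hh.continuous.mul (continuous_realLaplace hf)).add (continuous_inner_grad hf hh)

/-- The integrand is additive in `h`, so a partition of unity subordinate to the chart domains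
reduces it to `integral_green_of_tsupport_subset`. -/
theorem integral_green_eq_zero {f h : M → ℝ} (hf : ContMDiff (𝓡 d) 𝓘(ℝ, ℝ) ∞ f)
    (hh : ContMDiff (𝓡 d) 𝓘(ℝ, ℝ) ∞ h) :
    ∫ x, (h x * realLaplace d f x + inner ℝ (grad (d := d) f x) (grad h x))
      ∂riemannianVolume d M = 0 := by
  classical
  obtain ⟨ρ, hρ⟩ := SmoothPartitionOfUnity.exists_isSubordinate_chartAt_source (𝓡 d) M
  have hsm : ∀ i, ContMDiff (𝓡 d) 𝓘(ℝ, ℝ) ∞ fun x ↦ ρ i x * h x := fun i ↦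
    (ρ i).contMDiff.mul hh
  have hlocal : ∀ i, ∫ x, (ρ i x * h x * realLaplace d f x +
      inner ℝ (grad (d := d) f x) (grad (fun z ↦ ρ i z * h z) x)) ∂riemannianVolume d M = 0 := by
    intro i
    have hsupp : tsupport (fun x ↦ ρ i x * h x) ⊆ (chartAt 𝔼 i).source :=
      (tsupport_mul_subset_left (f := ρ i) (g := h)).trans (hρ i)
    rw [← integral_green_of_tsupport_subset hf (hsm i) hsupp]
    refine integral_congr_ae (ae_of_all _ fun x ↦ ?_)
    simp only
    by_cases hx : x ∈ tsupport (fun x ↦ ρ i x * h x)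
    · rw [realLaplace_eq hf (hsupp hx)]
    · rw [image_eq_zero_of_notMem_tsupport hx, zero_mul, zero_mul]
  have hsum_sm : ∀ s : Finset M, ContMDiff (𝓡 d) 𝓘(ℝ, ℝ) ∞ fun x ↦ ∑ i ∈ s, ρ i x * h x :=
    fun s ↦ contMDiff_finsetSum fun i _ ↦ hsm i
  have hsum : ∀ s : Finset M, ∫ x, ((∑ i ∈ s, ρ i x * h x) * realLaplace d f x +
      inner ℝ (grad (d := d) f x) (grad (fun z ↦ ∑ i ∈ s, ρ i z * h z) x))
        ∂riemannianVolume d M = 0 := by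
    intro s
    induction s using Finset.induction_on with
    | empty =>
      refine integral_eq_zero_of_ae (ae_of_all _ fun x ↦ ?_)
      simp only [Finset.sum_empty, zero_mul, zero_add, Pi.zero_apply]
      exact inner_grad_eq_zero (by simp [tsupport])
    | insert i s hi ih =>
      refine Eq.trans ?_ ((congrArg₂ HAdd.hAdd (hlocal i) ih).trans (add_zero 0))
      rw [← integral_add
        (integrable_riemannianVolume_of_continuous d (continuous_green hf (hsm i)))
        (integrable_riemannianVolume_of_continuous d (continuous_green hf (hsum_sm s)))]
      refine integral_congr_ae (ae_of_all _ fun x ↦ ?_)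
      simp only [Finset.sum_insert hi]
      rw [inner_grad_add (hsm i) (hsum_sm s)]
      ring
  -- Compactness leaves finitely many nonzero members of the partition, so additivity over finite
  -- sets suffices.
  have hfin := ρ.locallyFinite.finite_nonempty_of_compact
  have heq : (fun x ↦ ∑ i ∈ hfin.toFinset, ρ i x * h x) = h := by
    funext x
    rw [← Finset.sum_mul, ← finsum_eq_sum_of_support_subset _ ?_, ρ.sum_eq_one (mem_univ x),
      one_mul]
    intro i hi
    simp only [Finite.coe_toFinset]
    exact ⟨x, hi⟩
  have := hsum hfin.toFinset
  rw [heq] at this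
  simpa only [congrFun heq] using this

theorem continuous_laplaceBeltrami {F : M → ℂ} (hF : ContMDiff (𝓡 d) 𝓘(ℝ, ℂ) ∞ F) :
    Continuous (laplaceBeltrami (d := d) F) := by
  have h : laplaceBeltrami (d := d) F = fun x ↦
      ((realLaplace d (fun z ↦ (F z).re) x : ℝ) : ℂ) +
        (realLaplace d (fun z ↦ (F z).im) x : ℝ) * Complex.I := by
    funext x
    rw [laplaceBeltrami_eq hF, Complex.mk_eq_add_mul_I]
  rw [h]
  exact (Complex.continuous_ofReal.comp (continuous_realLaplace (contMDiff_re hF))).add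
    ((Complex.continuous_ofReal.comp (continuous_realLaplace (contMDiff_im hF))).mul
      continuous_const)

/-- Green's formula on a compact Riemannian manifold without boundary. -/
theorem integral_inner_laplaceBeltrami {F H : M → ℂ} (hF : ContMDiff (𝓡 d) 𝓘(ℝ, ℂ) ∞ F)
    (hH : ContMDiff (𝓡 d) 𝓘(ℝ, ℂ) ∞ H) :
    ∫ x, inner ℝ (laplaceBeltrami (d := d) F x) (H x) ∂riemannianVolume d M =
      -∫ x, inner ℝ (complexGrad (d := d) F x) (complexGrad H x) ∂riemannianVolume d M := by
  rw [← sub_eq_zero, sub_neg_eq_add, ← integral_add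
    (integrable_riemannianVolume_of_continuous d
      ((continuous_laplaceBeltrami hF).inner hH.continuous))
    (integrable_riemannianVolume_of_continuous d (continuous_inner_complexGrad hF hH))]
  have hre := integral_green_eq_zero (contMDiff_re hF) (contMDiff_re hH)
  have him := integral_green_eq_zero (contMDiff_im hF) (contMDiff_im hH)
  refine Eq.trans ?_ ((congrArg₂ HAdd.hAdd hre him).trans (add_zero 0))
  rw [← integral_add
    (integrable_riemannianVolume_of_continuous d
      (continuous_green (contMDiff_re hF) (contMDiff_re hH)))
    (integrable_riemannianVolume_of_continuous d
      (continuous_green (contMDiff_im hF) (contMDiff_im hH)))]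
  refine integral_congr_ae (ae_of_all _ fun x ↦ ?_)
  simp only [inner_complexGrad, laplaceBeltrami_eq hF, Complex.inner, Complex.mul_re,
    Complex.conj_re, Complex.conj_im]
  ring

end GlobalGreen

/-! ### From convergence of integrals to convergence in `Lp`. -/

section Approximation

variable {α : Type*} [MeasurableSpace α] {μ : Measure α}

theorem eLpNorm_two_eq {E : Type*} [NormedAddCommGroup E] (f : α → E) :
    eLpNorm f 2 μ = (∫⁻ x, ‖f x‖ₑ ^ 2 ∂μ) ^ (1 / 2 : ℝ) := by
  rw [eLpNorm_eq_lintegral_rpow_enorm_toReal (by simp) (by simp)]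
  simp

/-- Square integrability of the limit is part of the conclusion: `g` is at finite `L²` distance from
some `f n`. -/
theorem tendsto_toLp_of_tendsto_lintegral {E : Type*} [NormedAddCommGroup E] {f : ℕ → α → E}
    {g : α → E} (hf : ∀ n, MemLp (f n) 2 μ) (hg : AEStronglyMeasurable g μ)
    (h : Tendsto (fun n ↦ ∫⁻ x, ‖f n x - g x‖ₑ ^ 2 ∂μ) atTop (𝓝 0)) :
    ∃ hg' : MemLp g 2 μ, Tendsto (fun n ↦ (hf n).toLp (f n)) atTop (𝓝 (hg'.toLp g)) := by
  have h2 : Tendsto (fun n ↦ eLpNorm (f n - g) 2 μ) atTop (𝓝 0) := by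
    have h3 := h.ennrpow_const (1 / 2 : ℝ)
    rw [ENNReal.zero_rpow_of_pos (by norm_num)] at h3
    refine h3.congr fun n ↦ ?_
    rw [eLpNorm_two_eq]
    rfl
  have hg' : MemLp g 2 μ := by
    obtain ⟨n, hn⟩ := (h2.eventually (gt_mem_nhds ENNReal.zero_lt_top)).exists
    have hsub : MemLp (f n - g) 2 μ := ⟨(hf n).aestronglyMeasurable.sub hg, hn⟩
    have := (hf n).sub hsub
    rwa [sub_sub_cancel] at this
  exact ⟨hg', (Lp.tendsto_Lp_iff_tendsto_eLpNorm'' _ hf _ hg').2 h2⟩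

theorem tendsto_toLp_coe_of_tendsto_lintegral {E : Type*} [NormedAddCommGroup E] {f : ℕ → α → E}
    {g : Lp E 2 μ} (hf : ∀ n, MemLp (f n) 2 μ)
    (h : Tendsto (fun n ↦ ∫⁻ x, ‖f n x - g x‖ₑ ^ 2 ∂μ) atTop (𝓝 0)) :
    Tendsto (fun n ↦ (hf n).toLp (f n)) atTop (𝓝 g) := by
  obtain ⟨hg, ht⟩ := tendsto_toLp_of_tendsto_lintegral hf (Lp.aestronglyMeasurable g) h
  rwa [Lp.toLp_coeFn] at ht

theorem inner_toLp_toLp {E : Type*} [NormedAddCommGroup E] [InnerProductSpace ℝ E] {f g : α → E}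
    (hf : MemLp f 2 μ) (hg : MemLp g 2 μ) :
    inner ℝ (hf.toLp f) (hg.toLp g) = ∫ x, inner ℝ (f x) (g x) ∂μ := by
  rw [L2.inner_def]
  refine integral_congr_ae ?_
  filter_upwards [hf.coeFn_toLp, hg.coeFn_toLp] with x h1 h2
  rw [h1, h2]

end Approximation

/-! ### Passage of Green's formula to `H²`. -/

section SobolevGreen

variable {d : ℕ} {M : Type*} [TopologicalSpace M] [ChartedSpace (EuclideanSpace ℝ (Fin d)) M]
  [IsManifold (𝓡 d) ∞ M] [RiemannianBundle (fun x : M ↦ TangentSpace (𝓡 d) x)]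
  [IsContMDiffRiemannianBundle (𝓡 d) ∞ (EuclideanSpace ℝ (Fin d))
    (fun x : M ↦ TangentSpace (𝓡 d) x)]
  [CompactSpace M] [MeasurableSpace M] [BorelSpace M]

theorem memLp_riemannianVolume_of_continuous {F : Type*} [NormedAddCommGroup F] {f : M → F}
    (hf : Continuous f) : MemLp f 2 (riemannianVolume d M) :=
  hf.memLp_of_hasCompactSupport (HasCompactSupport.of_compactSpace f)

variable [T2Space M]

/-- The Laplace-Beltrami operator is symmetric on `H²`. -/
theorem IsH2Function.inner_lap_comm {u₁ u₂ w₁ w₂ : L2 d M ℂ} {X₁ X₂ : ∀ x, ComplexTangentSpace d x}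
    (h₁ : IsH2Function u₁ X₁ w₁) (h₂ : IsH2Function u₂ X₂ w₂) :
    inner ℝ w₁ u₂ = inner ℝ w₂ u₁ := by
  obtain ⟨f, hf, hfu, -, -, hfw⟩ := h₁
  obtain ⟨g, hg, hgu, -, -, hgw⟩ := h₂
  have mf := fun n ↦ memLp_riemannianVolume_of_continuous (d := d) (hf n).continuous
  have mg := fun n ↦ memLp_riemannianVolume_of_continuous (d := d) (hg n).continuous
  have mΔf := fun n ↦ memLp_riemannianVolume_of_continuous (d := d)
    (continuous_laplaceBeltrami (hf n))
  have mΔg := fun n ↦ memLp_riemannianVolume_of_continuous (d := d)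
    (continuous_laplaceBeltrami (hg n))
  have l₁ := (tendsto_toLp_coe_of_tendsto_lintegral mΔf hfw).inner (𝕜 := ℝ)
    (tendsto_toLp_coe_of_tendsto_lintegral mg hgu)
  have l₂ := (tendsto_toLp_coe_of_tendsto_lintegral mΔg hgw).inner (𝕜 := ℝ)
    (tendsto_toLp_coe_of_tendsto_lintegral mf hfu)
  refine tendsto_nhds_unique l₁ (l₂.congr fun n ↦ ?_)
  rw [inner_toLp_toLp, inner_toLp_toLp, integral_inner_laplaceBeltrami (hf n) (hg n),
    integral_inner_laplaceBeltrami (hg n) (hf n)]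
  simp only [real_inner_comm]

/-- The Dirichlet integral of an `H²` function. -/
theorem IsH2Function.integral_norm_grad_sq {u w : L2 d M ℂ} {X : ∀ x, ComplexTangentSpace d x}
    (h : IsH2Function u X w) :
    Integrable (fun x ↦ ‖X x‖ ^ 2) (riemannianVolume d M) ∧
      ∫ x, ‖X x‖ ^ 2 ∂riemannianVolume d M = -inner ℝ w u := by
  obtain ⟨f, hf, hfu, hfX, hfae, hfw⟩ := h
  have mf := fun n ↦ memLp_riemannianVolume_of_continuous (d := d) (hf n).continuous
  have mΔf := fun n ↦ memLp_riemannianVolume_of_continuous (d := d)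
    (continuous_laplaceBeltrami (hf n))
  have mN := fun n ↦ memLp_riemannianVolume_of_continuous (d := d)
    (continuous_norm_complexGrad (hf n))
  -- The gradient is a section and not an element of an `Lp` space, so the argument uses only its
  -- scalar norm, whose measurability comes from almost everywhere convergence.
  have hX : AEStronglyMeasurable (fun x ↦ ‖X x‖) (riemannianVolume d M) :=
    aestronglyMeasurable_of_tendsto_ae atTop (fun n ↦ (mN n).aestronglyMeasurable)
      (hfae.mono fun x hx ↦ hx.norm)
  have hN : Tendsto (fun n ↦ ∫⁻ x, ‖‖complexGrad (d := d) (f n) x‖ - ‖X x‖‖ₑ ^ 2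
      ∂riemannianVolume d M) atTop (𝓝 0) := by
    -- The reverse triangle inequality passes convergence of the gradients to their norms.
    refine tendsto_of_tendsto_of_tendsto_of_le_of_le tendsto_const_nhds hfX
      (fun _ ↦ zero_le) fun n ↦ lintegral_mono fun x ↦ ?_
    gcongr
    rw [enorm_le_iff_norm_le, Real.norm_eq_abs]
    exact abs_norm_sub_norm_le _ _
  obtain ⟨mX, lX⟩ := tendsto_toLp_of_tendsto_lintegral mN hX hN
  have hsq := (memLp_two_iff_integrable_sq hX).1 mX
  refine ⟨hsq, ?_⟩
  have l₁ := lX.inner (𝕜 := ℝ) lX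
  have l₂ := ((tendsto_toLp_coe_of_tendsto_lintegral mΔf hfw).inner (𝕜 := ℝ)
    (tendsto_toLp_coe_of_tendsto_lintegral mf hfu)).neg
  have heq : ∫ x, ‖X x‖ ^ 2 ∂riemannianVolume d M = inner ℝ (mX.toLp _) (mX.toLp _) := by
    rw [inner_toLp_toLp]
    simp only [Real.inner_apply, pow_two]
  rw [heq]
  refine tendsto_nhds_unique l₁ (l₂.congr fun n ↦ ?_)
  rw [inner_toLp_toLp, inner_toLp_toLp, integral_inner_laplaceBeltrami (hf n) (hf n), neg_neg]
  simp only [real_inner_self_eq_norm_sq, norm_norm]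

end SobolevGreen

end SchrodingerDebye

end

theorem proposition4p2 {d : ℕ} (hd : 2 ≤ d)
    {M : Type*} [TopologicalSpace M] [T2Space M] [CompactSpace M]
    [ChartedSpace (EuclideanSpace ℝ (Fin d)) M] [IsManifold (𝓡 d) ∞ M]
    [RiemannianBundle (fun x : M ↦ TangentSpace (𝓡 d) x)]
    [IsContMDiffRiemannianBundle (𝓡 d) ∞ (EuclideanSpace ℝ (Fin d))
      (fun x : M ↦ TangentSpace (𝓡 d) x)]
    [MeasurableSpace M] [BorelSpace M]
    (κ lam T : ℝ) (hκ : 0 < κ) (hlam : lam = 1 ∨ lam = -1) (hT : 0 < T)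
    (u : ℝ → SchrodingerDebye.L2 d M ℂ) (v : ℝ → SchrodingerDebye.L2 d M ℝ)
    (gradu : ℝ → ∀ x : M, SchrodingerDebye.ComplexTangentSpace d x)
    (lapu : ℝ → SchrodingerDebye.L2 d M ℂ)
    (hsol : SchrodingerDebye.IsH2Solution κ lam T u v gradu lapu) :
    ∀ t ∈ Icc 0 T,
      Integrable (fun x ↦ ‖gradu t x‖ ^ 2) (SchrodingerDebye.riemannianVolume d M) ∧
      Integrable (fun x ↦ ‖u t x‖ ^ 2 * v t x) (SchrodingerDebye.riemannianVolume d M) ∧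
      Integrable (fun x ↦ ‖u t x‖ ^ 4) (SchrodingerDebye.riemannianVolume d M) ∧
      HasDerivWithinAt
        (fun s ↦ (∫ x, ‖gradu s x‖ ^ 2 ∂SchrodingerDebye.riemannianVolume d M) +
          ∫ x, ‖u s x‖ ^ 2 * v s x ∂SchrodingerDebye.riemannianVolume d M)
        (1 / κ * (-(∫ x, ‖u t x‖ ^ 2 * v t x ∂SchrodingerDebye.riemannianVolume d M) +
          lam * ∫ x, ‖u t x‖ ^ 4 ∂SchrodingerDebye.riemannianVolume d M))
        (Icc 0 T) t := by
  have hderiv_u : ∀ t ∈ Icc 0 T, HasDerivWithinAt u (derivWithin u (Icc 0 T) t) (Icc 0 T) t :=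
    fun t ht ↦ (hsol.contDiffOn_u.differentiableOn one_ne_zero t ht).hasDerivWithinAt
  have hderiv_v : ∀ t ∈ Icc 0 T, HasDerivWithinAt v (derivWithin v (Icc 0 T) t) (Icc 0 T) t :=
    fun t ht ↦ (hsol.contDiffOn_v.differentiableOn one_ne_zero t ht).hasDerivWithinAt
  have energy := SchrodingerDebye.hasDerivWithinAt_energy hκ hlam hderiv_u hderiv_v
    (hsol.contDiffOn_u.continuousOn_derivWithin (uniqueDiffOn_Icc hT) le_rfl)
    (hsol.contDiffOn_v.continuousOn_derivWithin (uniqueDiffOn_Icc hT) le_rfl)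
    hsol.continuousOn_lap
    (fun s hs t ht ↦ (hsol.isH2Function s hs).inner_lap_comm (hsol.isH2Function t ht))
    hsol.schrodinger hsol.debye
  -- This identifies the abstract term `-⟨Δu, u⟩` of `energy` with the Dirichlet integral.
  have dirichlet := fun s hs ↦ (hsol.isH2Function s hs).integral_norm_grad_sq
  intro t ht
  obtain ⟨h2, h4, hd'⟩ := energy t ht
  refine ⟨(dirichlet t ht).1, h2, h4, hd'.congr (fun s hs ↦ ?_) ?_⟩
  · rw [(dirichlet s hs).2]
  · rw [(dirichlet t ht).2]
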